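/- **Setting.** Let $\mathcal D$ be the space of smooth compactly supported functions $\mathbb R\to\mathbb C$. For $q\in\mathbb N_0$ let $A_q$ be the set of $\varphi\in\mathcal D$ with $\int\varphi=1$ and $\int x^j\varphi(x)\,dx=0$ for $1\le j\le q$. For $\varphi\in A_0$ and $\varepsilon>0$ put $\varphi_\varepsilon(x)=\varepsilon^{-1}\varphi(\varepsilon^{-1}x)$ and $s(\varphi)=\sup\{|x|:\varphi(x)\neq0\}$. The Colombeau algebra is $\mathcal G(\mathbb R)=\mathcal E_M/\mathcal I$. Here $\mathcal E_M$ consists of the functions $F:A_0\times\mathbb R\to\mathbb C$, smooth in $x$, such that for every compact $K$ and $p\in\mathbb N_0$ there is $q$ with $\sup_{x\in K}|\partial_x^pF(\varphi_\varepsilon,x)|=O(\varepsilon^{-q})$ as $\varepsilon\to0_+$ for all $\varphi\in A_q$. The ideal $\mathcal I$ consists of those $F\in\mathcal E_M$ such that for every compact $K$ and $p\in\mathbb N_0$ there is $q$ with $\sup_{x\in K}|\partial_x^pF(\varphi_\varepsilon,x)|=O(\varepsilon^{r-q})$ for all $r\ge q$ and $\varphi\in A_r$. An element $U\in\mathcal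 G(\mathbb R)$ is associated with a distribution $u$, written $U\approx u$, if it has a representative $F$ such that for every $\psi\in\mathcal D$ there is $q$ with $\lim_{\varepsilon\to0_+}\int F(\varphi_\varepsilon,x)\psi(x)\,dx=\langle u,\psi\rangle$ for all $\varphi\in A_q$. **The $\delta$-model.** For $s>0$ let $D(s,\cdot)\in\mathcal D$ be even with $$\frac1s\int_{\mathbb R}D(s,x)^2\,dx=\int_{\mathbb R}D(s,x)\,dx=1,$$ and suppose that $D(s,\cdot)$ stays bounded in $\mathcal D$ as $s\to0_+$: for all sufficiently small $s$ the supports lie in one fixed interval $[-l,l]$, and for each $k$ there is a constant $C_k$ with $|\partial_x^kD(s,x)|\le C_k$ for all $x$ and all sufficiently small $s>0$. (For example, $D(s,x)=f(x)+\lambda_s g(x)$, where $f,g\in\mathcal D$ are real-valued and even with disjoint supports, $g\neq0$, $\int f=1$, $\int g=0$ and $\lambda_s^2=(s-\int f^2)/\int g^2$.) Put $D_\sigma(x)=\sigma^{-1}D(\sigma,x/\sigma)$. The model of a distribution $u$ is the element of $\mathcal G(\mathbb R)$ with representative $(\varphi,x)\mapsto(u*D_{s(\varphi)})(x)$. **The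 singularities.** Let $\theta$ be the Heaviside function, $\check\theta(x)=\theta(-x)$, $\ln x_+=\ln x$ for $x>0$ and $0$ for $x<0$, $\ln x_-=\ln(-x)$ for $x<0$ and $0$ for $x>0$, and, with distributional derivatives, $$x_+^{-2}=-\partial^2\ln x_+-\delta',\qquad x_-^{-2}=-\partial^2\ln x_-+\delta'.$$ Let $D,\ D',\ H,\ \check H,\ \mathrm{Ln}\,x_\pm,\ X_\pm^{-2}\in\mathcal G(\mathbb R)$ be the models of $\delta,\ \delta',\ \theta,\ \check\theta,\ \ln x_\pm,\ x_\pm^{-2}$, respectively. **Theorem.** One has $D\approx\delta$ and $D^2\approx\delta$, and $$X_-^{-2}\cdot H-\mathrm{Ln}\,x_+\cdot D'\ \approx\ -\delta,\qquad X_+^{-2}\cdot\check H+\mathrm{Ln}\,x_-\cdot D'\ \approx\ -\delta .$$ -/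

import Mathlib

open scoped Distributions ContDiff Topology Pointwise
open Filter MeasureTheory

namespace Colombeau

noncomputable section

/-- Complex-valued test functions on the real line. -/
abbrev Test : Type := 𝓓((⊤ : TopologicalSpace.Opens ℝ), ℂ)

/-- Complex-valued Schwartz distributions on the real line. -/
abbrev Distr : Type := Test →L[ℂ] ℂ

/-- A smooth compactly supported function as a test function. -/
def Test.of (f : ℝ → ℂ) (h : ContDiff ℝ ∞ f) (hc : HasCompactSupport f) : Test :=
  ⟨f, h, hc, fun _ _ => trivial⟩

/-- The function `x ↦ ε⁻¹ χ(ε⁻¹ x)`. -/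
def dilate (ε : ℝ) (χ : Test) : Test :=
  Test.of (fun x => (ε⁻¹ : ℂ) * χ (ε⁻¹ * x))
    (contDiff_const.mul (χ.contDiff.comp (contDiff_const.mul contDiff_id)))
    (by
      rcases eq_or_ne ε 0 with rfl | h
      · have e : (fun x : ℝ => (((0 : ℝ) : ℂ)⁻¹) * χ ((0 : ℝ)⁻¹ * x)) = 0 := by
          funext x; simp
        rw [e]
        exact HasCompactSupport.zero
      · exact (χ.hasCompactSupport.comp_homeomorph
          (Homeomorph.mulLeft₀ ε⁻¹ (inv_ne_zero h))).mul_left)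

/-- The function `y ↦ χ(x - y)`. -/
def reflect (χ : Test) (x : ℝ) : Test :=
  Test.of (fun y => χ (x - y)) (χ.contDiff.comp (contDiff_const.sub contDiff_id))
    (χ.hasCompactSupport.comp_homeomorph (Homeomorph.subLeft x))

@[simp] lemma dilate_apply (ε : ℝ) (χ : Test) (x : ℝ) :
    dilate ε χ x = (ε⁻¹ : ℂ) * χ (ε⁻¹ * x) := rfl

@[simp] lemma reflect_apply (χ : Test) (x y : ℝ) : reflect χ x y = χ (x - y) := rfl

/-! ### The Colombeau algebra -/

/-- The set `A_q` of test functions with integral `1` whose moments of order `1, …, q` vanish. -/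
def A (q : ℕ) : Set Test :=
  {φ | ∀ j ≤ q, ∫ x : ℝ, (x : ℂ) ^ j * φ x = if j = 0 then 1 else 0}

lemma A_anti {q r : ℕ} (h : q ≤ r) : A r ⊆ A q := fun _ hφ j hj => hφ j (hj.trans h)

lemma dilate_mem_A {ε : ℝ} (hε : 0 < ε) {q : ℕ} {φ : Test} (hφ : φ ∈ A q) :
    dilate ε φ ∈ A q := by
  intro j hj
  have h := hφ j hj
  have key : ∀ x : ℝ, (x : ℂ) ^ j * dilate ε φ x =
      (ε : ℂ) ^ j * (ε⁻¹ : ℂ) * (fun y : ℝ => (y : ℂ) ^ j * φ y) (ε⁻¹ * x) := by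
    intro x
    have : (ε : ℂ) ≠ 0 := by exact_mod_cast hε.ne'
    simp only [dilate_apply]
    push_cast
    rw [mul_pow, inv_pow]
    field_simp
  simp_rw [key]
  rw [integral_const_mul,
    Measure.integral_comp_mul_left (fun y : ℝ => (y : ℂ) ^ j * φ y) ε⁻¹, h]
  rcases eq_or_ne j 0 with rfl | hj0
  · have : (ε : ℂ) ≠ 0 := by exact_mod_cast hε.ne'
    simp [abs_of_pos hε, this]
  · simp [hj0]

/-- The net `φ_ε(x) = ε⁻¹ φ(ε⁻¹ x)` in `A_0`, for `ε > 0` (other values of `ε` are never used). -/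
def scale (ε : ℝ) (φ : A 0) : A 0 :=
  if h : 0 < ε then ⟨dilate ε φ, dilate_mem_A h φ.2⟩ else φ

/-- `s(φ) = sup {|x| : φ(x) ≠ 0}`. -/
def size (φ : Test) : ℝ := sSup ((fun x : ℝ => |x|) '' Function.support φ)

/-- Moderate functions `F(φ, x)`, smooth in `x`. -/
def IsModerate (F : A 0 → ℝ → ℂ) : Prop :=
  (∀ φ, ContDiff ℝ ∞ (F φ)) ∧
  ∀ (K : Set ℝ), IsCompact K → ∀ p : ℕ, ∃ q : ℕ, ∀ φ : A 0, (φ : Test) ∈ A q →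
    ∃ C : ℝ, ∀ᶠ ε in 𝓝[>] (0 : ℝ), ∀ x ∈ K,
      ‖iteratedDeriv p (F (scale ε φ)) x‖ ≤ C * (ε⁻¹) ^ q

/-- Null functions `F(φ, x)`. -/
def IsNull (F : A 0 → ℝ → ℂ) : Prop :=
  ∀ (K : Set ℝ), IsCompact K → ∀ p : ℕ, ∃ q : ℕ, ∀ r ≥ q, ∀ φ : A 0, (φ : Test) ∈ A r →
    ∃ C : ℝ, ∀ᶠ ε in 𝓝[>] (0 : ℝ), ∀ x ∈ K,
      ‖iteratedDeriv p (F (scale ε φ)) x‖ ≤ C * ε ^ (r - q)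

lemma eventually_small : ∀ᶠ ε in 𝓝[>] (0 : ℝ), 0 < ε ∧ ε < 1 := by
  filter_upwards [Ioo_mem_nhdsGT (show (0 : ℝ) < 1 by norm_num)] with ε h using h

/-- In the moderateness estimates one exponent can be used for all derivatives of order `≤ p`. -/
lemma IsModerate.uniform {F : A 0 → ℝ → ℂ} (hF : IsModerate F) {K : Set ℝ} (hK : IsCompact K)
    (p : ℕ) : ∃ q₀ : ℕ, ∀ q ≥ q₀, ∀ φ : A 0, (φ : Test) ∈ A q → ∃ C : ℝ, 0 ≤ C ∧
      ∀ᶠ ε in 𝓝[>] (0 : ℝ), ∀ i ≤ p, ∀ x ∈ K,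
        ‖iteratedDeriv i (F (scale ε φ)) x‖ ≤ C * (ε⁻¹) ^ q := by
  choose Q hQ using hF.2 K hK
  refine ⟨(Finset.range (p + 1)).sup Q, fun q hq φ hφ => ?_⟩
  have hQq : ∀ i ≤ p, Q i ≤ q := fun i hi =>
    (Finset.le_sup (Finset.mem_range.2 (by omega))).trans hq
  choose! C hC using fun i (hi : i ≤ p) => hQ i φ (A_anti (hQq i hi) hφ)
  refine ⟨∑ i ∈ Finset.range (p + 1), |C i|, Finset.sum_nonneg fun _ _ => abs_nonneg _, ?_⟩
  have h1 : ∀ᶠ ε in 𝓝[>] (0 : ℝ), ∀ i ∈ Finset.range (p + 1), ∀ x ∈ K,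
      ‖iteratedDeriv i (F (scale ε φ)) x‖ ≤ C i * (ε⁻¹) ^ Q i :=
    (Finset.eventually_all _).2 fun i hi => hC i (by simpa [Nat.lt_succ_iff] using hi)
  filter_upwards [h1, eventually_small] with ε h ⟨h0, hlt⟩ i hi x hx
  have hinv : 1 ≤ ε⁻¹ := (one_le_inv₀ h0).2 hlt.le
  have hmem : i ∈ Finset.range (p + 1) := Finset.mem_range.2 (by omega)
  calc _ ≤ C i * (ε⁻¹) ^ Q i := h i hmem x hx
    _ ≤ |C i| * (ε⁻¹) ^ Q i := by gcongr; exact le_abs_self _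
    _ ≤ (∑ i ∈ Finset.range (p + 1), |C i|) * (ε⁻¹) ^ q := by
        gcongr
        · exact Finset.single_le_sum (f := fun i => |C i|) (fun _ _ => abs_nonneg _) hmem
        · exact hQq i hi

lemma IsNull.uniform {F : A 0 → ℝ → ℂ} (hF : IsNull F) {K : Set ℝ} (hK : IsCompact K)
    (p : ℕ) : ∃ q₀ : ℕ, ∀ q ≥ q₀, ∀ r ≥ q, ∀ φ : A 0, (φ : Test) ∈ A r → ∃ C : ℝ, 0 ≤ C ∧
      ∀ᶠ ε in 𝓝[>] (0 : ℝ), ∀ i ≤ p, ∀ x ∈ K,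
        ‖iteratedDeriv i (F (scale ε φ)) x‖ ≤ C * ε ^ (r - q) := by
  choose Q hQ using hF K hK
  refine ⟨(Finset.range (p + 1)).sup Q, fun q hq r hr φ hφ => ?_⟩
  have hQq : ∀ i ≤ p, Q i ≤ q := fun i hi =>
    (Finset.le_sup (Finset.mem_range.2 (by omega))).trans hq
  choose! C hC using fun i (hi : i ≤ p) => hQ i r ((hQq i hi).trans hr) φ hφ
  refine ⟨∑ i ∈ Finset.range (p + 1), |C i|, Finset.sum_nonneg fun _ _ => abs_nonneg _, ?_⟩
  have h1 : ∀ᶠ ε in 𝓝[>] (0 : ℝ), ∀ i ∈ Finset.range (p + 1), ∀ x ∈ K,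
      ‖iteratedDeriv i (F (scale ε φ)) x‖ ≤ C i * ε ^ (r - Q i) :=
    (Finset.eventually_all _).2 fun i hi => hC i (by simpa [Nat.lt_succ_iff] using hi)
  filter_upwards [h1, eventually_small] with ε h ⟨h0, hlt⟩ i hi x hx
  have hmem : i ∈ Finset.range (p + 1) := Finset.mem_range.2 (by omega)
  calc _ ≤ C i * ε ^ (r - Q i) := h i hmem x hx
    _ ≤ |C i| * ε ^ (r - Q i) := by gcongr; exact le_abs_self _
    _ ≤ (∑ i ∈ Finset.range (p + 1), |C i|) * ε ^ (r - q) := by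
        refine mul_le_mul ?_ ?_ (by positivity) (Finset.sum_nonneg fun _ _ => abs_nonneg _)
        · exact Finset.single_le_sum (f := fun i => |C i|) (fun _ _ => abs_nonneg _) hmem
        · exact pow_le_pow_of_le_one h0.le hlt.le (by have := hQq i hi; omega)

lemma contDiffAt_nat {f : ℝ → ℂ} (h : ContDiff ℝ ∞ f) (n : ℕ) (x : ℝ) : ContDiffAt ℝ n f x :=
  (h.of_le (by exact_mod_cast le_top)).contDiffAt

lemma norm_iteratedDeriv_mul_le {f g : ℝ → ℂ} (hf : ContDiff ℝ ∞ f) (hg : ContDiff ℝ ∞ g)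
    (p : ℕ) (x : ℝ) {a b : ℝ} (ha : ∀ i ≤ p, ‖iteratedDeriv i f x‖ ≤ a)
    (hb : ∀ i ≤ p, ‖iteratedDeriv i g x‖ ≤ b) :
    ‖iteratedDeriv p (f * g) x‖ ≤ 2 ^ p * (a * b) := by
  have ha0 : 0 ≤ a := (norm_nonneg _).trans (ha 0 (Nat.zero_le _))
  rw [iteratedDeriv_mul (contDiffAt_nat hf p x) (contDiffAt_nat hg p x)]
  calc _ ≤ ∑ i ∈ Finset.range (p + 1), (p.choose i : ℝ) * (a * b) := by
        refine norm_sum_le_of_le _ fun i hi => ?_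
        rw [mul_assoc, norm_mul, norm_mul, Complex.norm_natCast]
        have hi' : i ≤ p := by simpa [Nat.lt_succ_iff] using hi
        gcongr
        · exact ha i hi'
        · exact hb _ (Nat.sub_le _ _)
    _ = 2 ^ p * (a * b) := by
        rw [← Finset.sum_mul]
        congr 1
        exact_mod_cast Nat.sum_range_choose p

lemma IsModerate.mul {F G : A 0 → ℝ → ℂ} (hF : IsModerate F) (hG : IsModerate G) :
    IsModerate (F * G) := by
  refine ⟨fun φ => (hF.1 φ).mul (hG.1 φ), fun K hK p => ?_⟩
  obtain ⟨q₁, h₁⟩ := hF.uniform hK p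
  obtain ⟨q₂, h₂⟩ := hG.uniform hK p
  refine ⟨q₁ + q₂, fun φ hφ => ?_⟩
  obtain ⟨C, -, hC⟩ := h₁ q₁ le_rfl φ (A_anti (by omega) hφ)
  obtain ⟨C', -, hC'⟩ := h₂ q₂ le_rfl φ (A_anti (by omega) hφ)
  refine ⟨2 ^ p * (C * C'), ?_⟩
  filter_upwards [hC, hC'] with ε h h' x hx
  refine (norm_iteratedDeriv_mul_le (hF.1 _) (hG.1 _) p x (fun i hi => h i hi x hx)
    (fun i hi => h' i hi x hx)).trans (le_of_eq ?_)
  rw [pow_add]; ring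

lemma IsModerate.add {F G : A 0 → ℝ → ℂ} (hF : IsModerate F) (hG : IsModerate G) :
    IsModerate (F + G) := by
  refine ⟨fun φ => (hF.1 φ).add (hG.1 φ), fun K hK p => ?_⟩
  obtain ⟨q₁, h₁⟩ := hF.uniform hK p
  obtain ⟨q₂, h₂⟩ := hG.uniform hK p
  refine ⟨q₁ + q₂, fun φ hφ => ?_⟩
  obtain ⟨C, -, hC⟩ := h₁ (q₁ + q₂) (by omega) φ hφ
  obtain ⟨C', -, hC'⟩ := h₂ (q₁ + q₂) (by omega) φ hφ
  refine ⟨C + C', ?_⟩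
  filter_upwards [hC, hC'] with ε h h' x hx
  rw [Pi.add_apply, iteratedDeriv_add (contDiffAt_nat (hF.1 _) p x) (contDiffAt_nat (hG.1 _) p x),
    add_mul]
  exact norm_add_le_of_le (h p le_rfl x hx) (h' p le_rfl x hx)

lemma IsModerate.const (c : ℂ) : IsModerate (fun _ _ => c) := by
  refine ⟨fun φ => contDiff_const, fun K hK p => ⟨0, fun φ _ => ⟨‖c‖, ?_⟩⟩⟩
  filter_upwards with ε x _
  rcases p with _ | p
  · simp
  · simp [iteratedDeriv_const]

/-- The algebra of moderate functions. -/
def Moderate : Subalgebra ℂ (A 0 → ℝ → ℂ) where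
  carrier := {F | IsModerate F}
  mul_mem' := IsModerate.mul
  add_mem' := IsModerate.add
  algebraMap_mem' c := IsModerate.const c

/-- The ideal of null functions in the algebra of moderate functions. -/
def Null : Ideal Moderate where
  carrier := {F | IsNull F.1}
  zero_mem' := by
    intro K _ p
    refine ⟨0, fun r _ φ _ => ⟨0, ?_⟩⟩
    filter_upwards with ε x _
    simp
  add_mem' := by
    intro F G hF hG K hK p
    obtain ⟨q₁, h₁⟩ := hF.uniform hK p
    obtain ⟨q₂, h₂⟩ := hG.uniform hK p
    refine ⟨q₁ + q₂, fun r hr φ hφ => ?_⟩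
    obtain ⟨C, -, hC⟩ := h₁ (q₁ + q₂) (by omega) r hr φ hφ
    obtain ⟨C', -, hC'⟩ := h₂ (q₁ + q₂) (by omega) r hr φ hφ
    refine ⟨C + C', ?_⟩
    filter_upwards [hC, hC'] with ε h h' x hx
    change ‖iteratedDeriv p (F.1 (scale ε φ) + G.1 (scale ε φ)) x‖ ≤ _
    rw [iteratedDeriv_add (contDiffAt_nat (F.2.1 _) p x) (contDiffAt_nat (G.2.1 _) p x), add_mul]
    exact norm_add_le_of_le (h p le_rfl x hx) (h' p le_rfl x hx)
  smul_mem' := by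
    intro G F hF K hK p
    obtain ⟨q₁, h₁⟩ := IsModerate.uniform G.2 hK p
    obtain ⟨q₂, h₂⟩ := hF.uniform hK p
    refine ⟨q₁ + q₂, fun r hr φ hφ => ?_⟩
    obtain ⟨C, -, hC⟩ := h₁ q₁ le_rfl φ (A_anti (by omega) hφ)
    obtain ⟨C', -, hC'⟩ := h₂ q₂ le_rfl r (by omega) φ hφ
    refine ⟨2 ^ p * (C * C'), ?_⟩
    filter_upwards [hC, hC', eventually_small] with ε h h' ⟨h0, _⟩ x hx
    refine (norm_iteratedDeriv_mul_le (G.2.1 _) (F.2.1 _) p x (fun i hi => h i hi x hx)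
      (fun i hi => h' i hi x hx)).trans (le_of_eq ?_)
    have e : r - q₂ = q₁ + (r - (q₁ + q₂)) := by omega
    rw [e, pow_add, inv_pow]
    field_simp

/-- The Colombeau algebra of generalized functions on the real line. -/
abbrev G : Type := Moderate ⧸ Null

/-- The generalized function with the given moderate representative. -/
def G.mk (F : A 0 → ℝ → ℂ) (hF : IsModerate F) : G := Ideal.Quotient.mk Null ⟨F, hF⟩

/-- The generalized function `U` is associated with the distribution `u`. -/
def Assoc (U : G) (u : Distr) : Prop :=
  ∃ (F : A 0 → ℝ → ℂ) (hF : IsModerate F), U = G.mk F hF ∧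
    ∀ ψ : Test, ∃ q : ℕ, ∀ φ : A 0, (φ : Test) ∈ A q →
      Tendsto (fun ε : ℝ => ∫ x : ℝ, F (scale ε φ) x * ψ x) (𝓝[>] 0) (𝓝 (u ψ))


/-! ### Distributions -/

/-- The distributional derivative. -/
def Distr.deriv (u : Distr) : Distr := -(u.comp (TestFunction.lineDerivCLM ℂ (1 : ℝ)))

/-- The distribution given by a locally integrable function. -/
def Distr.ofFun (f : ℝ → ℂ) : Distr :=
  TestFunction.integralAgainstBilinCLM (ContinuousLinearMap.mul ℂ ℂ) volume f

/-- The Dirac distribution at `0`. -/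
def delta : Distr where
  toFun ψ := ψ 0
  map_add' _ _ := rfl
  map_smul' _ _ := rfl
  cont := continuous_eval_const _

def lnPlusFun (x : ℝ) : ℂ := if 0 < x then (Real.log x : ℂ) else 0
def lnMinusFun (x : ℝ) : ℂ := if x < 0 then (Real.log (-x) : ℂ) else 0
def heavisideFun (x : ℝ) : ℂ := if 0 < x then 1 else 0
def heavisideRefFun (x : ℝ) : ℂ := if x < 0 then 1 else 0

lemma locallyIntegrable_log : LocallyIntegrable (fun x : ℝ => (Real.log x : ℂ)) := by
  rw [locallyIntegrable_iff]
  intro K hK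
  obtain ⟨a, b, hab⟩ : ∃ a b : ℝ, K ⊆ Set.Ioc a b := by
    obtain ⟨R, hR⟩ := hK.isBounded.subset_closedBall 0
    exact ⟨-R - 1, R, fun x hx => by
      have := hR hx
      rw [Real.closedBall_eq_Icc] at this
      constructor <;> linarith [this.1, this.2]⟩
  refine IntegrableOn.mono_set ?_ hab
  rcases le_total a b with h | h
  · exact ((intervalIntegrable_iff_integrableOn_Ioc_of_le h).1
      intervalIntegral.intervalIntegrable_log').ofReal
  · simp [Set.Ioc_eq_empty (not_lt.2 h)]

lemma locallyIntegrable_lnPlusFun : LocallyIntegrable lnPlusFun := by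
  have h : lnPlusFun = (Set.Ioi (0 : ℝ)).indicator (fun x : ℝ => (Real.log x : ℂ)) := by
    funext x; simp [lnPlusFun, Set.indicator]
  rw [h]
  exact locallyIntegrable_log.indicator measurableSet_Ioi

lemma locallyIntegrable_lnMinusFun : LocallyIntegrable lnMinusFun := by
  have h : lnMinusFun = (Set.Iio (0 : ℝ)).indicator (fun x : ℝ => (Real.log x : ℂ)) := by
    funext x; simp [lnMinusFun, Set.indicator]
  rw [h]
  exact locallyIntegrable_log.indicator measurableSet_Iio

lemma locallyIntegrable_heavisideFun : LocallyIntegrable heavisideFun := by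
  have h : heavisideFun = (Set.Ioi (0 : ℝ)).indicator (fun _ : ℝ => (1 : ℂ)) := by
    funext x; simp [heavisideFun, Set.indicator]
  rw [h]
  exact (locallyIntegrable_const 1).indicator measurableSet_Ioi

lemma locallyIntegrable_heavisideRefFun : LocallyIntegrable heavisideRefFun := by
  have h : heavisideRefFun = (Set.Iio (0 : ℝ)).indicator (fun _ : ℝ => (1 : ℂ)) := by
    funext x; simp [heavisideRefFun, Set.indicator]
  rw [h]
  exact (locallyIntegrable_const 1).indicator measurableSet_Iio

/-- The distributions `ln x₊` and `ln x₋`. -/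
def lnPlus : Distr := Distr.ofFun lnPlusFun
def lnMinus : Distr := Distr.ofFun lnMinusFun

/-- The step function `θ` and its reflection `x ↦ θ(-x)`. -/
def heaviside : Distr := Distr.ofFun heavisideFun
def heavisideRef : Distr := Distr.ofFun heavisideRefFun

/-- The harmonic number `κ_p = 1 + 1/2 + ⋯ + 1/p`. -/
def kappa (p : ℕ) : ℂ := ∑ k ∈ Finset.Icc 1 p, (1 : ℂ) / k

/-- The distribution `x₊^{-(p+1)}`. -/
def negPowPlus (p : ℕ) : Distr :=
  ((-1) ^ p / (p.factorial : ℂ)) • Distr.deriv^[p + 1] lnPlus +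
    ((-1) ^ p * kappa p / (p.factorial : ℂ)) • Distr.deriv^[p] delta

/-- The distribution `x₋^{-(p+1)}`. -/
def negPowMinus (p : ℕ) : Distr :=
  (-1 / (p.factorial : ℂ)) • Distr.deriv^[p + 1] lnMinus +
    (kappa p / (p.factorial : ℂ)) • Distr.deriv^[p] delta

/-- The convolution `(u * χ)(x) = ⟨u_y, χ(x - y)⟩`. -/
def conv (u : Distr) (χ : Test) (x : ℝ) : ℂ := u (reflect χ x)

/-! ### Smoothness and bounds for the convolution -/

/-- The derivative of a test function. -/
def Test.deriv (χ : Test) : Test := TestFunction.lineDerivCLM ℂ (1 : ℝ) χ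

lemma Test.coe_deriv (χ : Test) : ⇑χ.deriv = _root_.deriv χ := by
  funext x
  have : χ.deriv x = lineDeriv ℝ χ x 1 := by simp [Test.deriv]
  rw [this]
  simp [lineDeriv, deriv_comp_const_add]

lemma Test.coe_deriv_iterate (χ : Test) (k : ℕ) : ⇑(Test.deriv^[k] χ) = iteratedDeriv k χ := by
  induction k with
  | zero => simp
  | succ k ih => rw [Function.iterate_succ_apply', Test.coe_deriv, ih, iteratedDeriv_succ]

/-- A distribution has finite order on each bounded interval. -/
lemma Distr.bound (u : Distr) (R : ℝ) : ∃ (N : ℕ) (C : ℝ), 0 ≤ C ∧ ∀ (ψ : Test) (B : ℝ), 0 ≤ B →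
    (∀ x, ψ x ≠ 0 → |x| ≤ R) → (∀ i ≤ N, ∀ x, ‖iteratedDeriv i ψ x‖ ≤ B) → ‖u ψ‖ ≤ C * B := by
  let K : TopologicalSpace.Compacts ℝ := ⟨Set.Icc (-R) R, isCompact_Icc⟩
  have hK : (K : Set ℝ) ⊆ ((⊤ : TopologicalSpace.Opens ℝ) : Set ℝ) := fun _ _ => trivial
  let v : 𝓓^{⊤}_{K}(ℝ, ℂ) →L[ℂ] ℂ := u.comp (TestFunction.ofSupportedInCLM ℂ hK)
  have hv : Continuous ((normSeminorm ℂ ℂ).comp v.toLinearMap) :=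
    continuous_norm.comp v.continuous
  obtain ⟨s, C, -, hC⟩ := Seminorm.bound_of_continuous
    (ContDiffMapSupportedIn.withSeminorms ℂ ℝ ℂ ⊤ K) _ hv
  refine ⟨s.sup id, C, C.2, fun ψ B hB hsupp hder => ?_⟩
  let f : 𝓓^{⊤}_{K}(ℝ, ℂ) := ⟨ψ, ψ.contDiff, fun x hx => by
    by_contra h
    exact hx (abs_le.1 (hsupp x h))⟩
  have e : u ψ = v f := rfl
  rw [e]
  refine (hC f).trans ?_
  change (C : ℝ) * _ ≤ _
  gcongr
  refine Seminorm.finset_sup_apply_le hB fun i hi => ?_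
  rw [ContDiffMapSupportedIn.seminorm_top_le_iff ℂ hB]
  intro x _
  rw [norm_iteratedFDeriv_eq_norm_iteratedDeriv]
  exact hder i (Finset.le_sup (f := id) hi) x

lemma Test.exists_support (χ : Test) : ∃ l : ℝ, ∀ x, χ x ≠ 0 → |x| ≤ l := by
  obtain ⟨R, hR⟩ := χ.hasCompactSupport.isBounded.subset_closedBall 0
  exact ⟨R, fun x hx => by simpa using hR (subset_tsupport _ hx)⟩

lemma Test.support_deriv (χ : Test) {l : ℝ} (hl : ∀ x, χ x ≠ 0 → |x| ≤ l) :
    ∀ x, χ.deriv x ≠ 0 → |x| ≤ l := by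
  intro x hx
  by_contra hcon
  apply hx
  rw [Test.coe_deriv]
  have : χ =ᶠ[𝓝 x] fun _ => 0 := by
    filter_upwards [(isOpen_lt continuous_const continuous_abs).mem_nhds (not_le.1 hcon)] with y hy
    by_contra h
    exact absurd (hl y h) (not_le.2 hy)
  rw [this.deriv_eq]; simp

lemma Test.support_deriv_iterate (χ : Test) {l : ℝ} (hl : ∀ x, χ x ≠ 0 → |x| ≤ l) (k : ℕ) :
    ∀ x, Test.deriv^[k] χ x ≠ 0 → |x| ≤ l := by
  induction k with
  | zero => simpa using hl
  | succ k ih => rw [Function.iterate_succ_apply']; exact Test.support_deriv _ ih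

lemma Test.exists_bound (χ : Test) (k : ℕ) : ∃ C : ℝ, 0 ≤ C ∧ ∀ x, ‖iteratedDeriv k χ x‖ ≤ C := by
  obtain ⟨C, hC⟩ := (Test.deriv^[k] χ).continuous.bounded_above_of_compact_support
    (Test.deriv^[k] χ).hasCompactSupport
  refine ⟨C, (norm_nonneg _).trans (hC 0), fun x => ?_⟩
  rw [← Test.coe_deriv_iterate]; exact hC x

lemma Test.exists_bound_le (χ : Test) (N : ℕ) :
    ∃ C : ℝ, 0 ≤ C ∧ ∀ k ≤ N, ∀ x, ‖iteratedDeriv k χ x‖ ≤ C := by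
  choose C h0 hC using χ.exists_bound
  refine ⟨∑ k ∈ Finset.range (N + 1), C k, Finset.sum_nonneg fun _ _ => h0 _, fun k hk x => ?_⟩
  exact (hC k x).trans (Finset.single_le_sum (f := C) (fun _ _ => h0 _)
    (Finset.mem_range.2 (by omega)))

lemma Test.hasDerivAt_iterate (χ : Test) (k : ℕ) (x : ℝ) :
    HasDerivAt (iteratedDeriv k χ) (iteratedDeriv (k + 1) χ x) x := by
  rw [← Test.coe_deriv_iterate, ← Test.coe_deriv_iterate, Function.iterate_succ_apply',
    Test.coe_deriv]
  exact ((Test.deriv^[k] χ).contDiff.differentiable (by simp)).differentiableAt.hasDerivAt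

/-- First order Taylor estimate, uniform in the point. -/
lemma taylor_bound (χ : Test) (k : ℕ) {M : ℝ}
    (hM : ∀ x, ‖iteratedDeriv (k + 2) χ x‖ ≤ M) (a h : ℝ) :
    ‖iteratedDeriv k χ (a + h) - iteratedDeriv k χ a - h * iteratedDeriv (k + 1) χ a‖
      ≤ M * h ^ 2 := by
  have lip : ∀ x y, ‖iteratedDeriv (k + 1) χ y - iteratedDeriv (k + 1) χ x‖ ≤ M * ‖y - x‖ :=
    fun x y => Convex.norm_image_sub_le_of_norm_hasDerivWithin_le
      (fun z _ => (χ.hasDerivAt_iterate (k + 1) z).hasDerivWithinAt) (fun z _ => hM z)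
      convex_univ trivial trivial
  have hM0 : 0 ≤ M := (norm_nonneg _).trans (hM 0)
  let g : ℝ → ℂ := fun t => iteratedDeriv k χ (a + t) - t * iteratedDeriv (k + 1) χ a
  have hg : ∀ t, HasDerivAt g
      (iteratedDeriv (k + 1) χ (a + t) - iteratedDeriv (k + 1) χ a) t := by
    intro t
    have h1 := (χ.hasDerivAt_iterate k (a + t)).comp_const_add a t
    have h2 := ((Complex.ofRealCLM.hasDerivAt (x := t)).mul_const (iteratedDeriv (k + 1) χ a))
    have h3 := h1.sub h2
    simp only [Complex.ofRealCLM_apply, Complex.ofReal_one, one_mul] at h3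
    exact h3
  have := Convex.norm_image_sub_le_of_norm_hasDerivWithin_le (s := Set.uIcc 0 h) (C := M * |h|)
    (fun t _ => (hg t).hasDerivWithinAt) (fun t ht => by
      refine (lip a (a + t)).trans ?_
      have : |t| ≤ |h| := by simpa using Set.abs_sub_left_of_mem_uIcc ht
      simpa using mul_le_mul_of_nonneg_left this hM0) (convex_uIcc 0 h)
    Set.left_mem_uIcc Set.right_mem_uIcc
  have e : g h - g 0 =
      iteratedDeriv k χ (a + h) - iteratedDeriv k χ a - h * iteratedDeriv (k + 1) χ a := by
    simp [g]; ring
  rw [e] at this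
  refine this.trans (le_of_eq ?_)
  rw [sub_zero, Real.norm_eq_abs, mul_assoc, abs_mul_abs_self, sq]

lemma iteratedDeriv_reflect (χ : Test) (x : ℝ) (i : ℕ) (y : ℝ) :
    iteratedDeriv i (reflect χ x) y = (-1) ^ i * iteratedDeriv i χ (x - y) := by
  have := congrFun (iteratedDeriv_comp_const_sub i χ x) y
  change iteratedDeriv i (fun z => χ (x - z)) y = _
  simpa using this

lemma conv_hasDerivAt (u : Distr) (χ : Test) (x : ℝ) :
    HasDerivAt (conv u χ) (conv u χ.deriv x) x := by
  obtain ⟨l, hl⟩ := χ.exists_support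
  have hl' := χ.support_deriv hl
  obtain ⟨N, C, hC0, hC⟩ := u.bound (|x| + 1 + l)
  obtain ⟨M, hM0, hM⟩ := χ.exists_bound_le (N + 2)
  have key : ∀ h : ℝ, |h| ≤ 1 →
      ‖conv u χ (x + h) - conv u χ x - h * conv u χ.deriv x‖ ≤ C * (M * h ^ 2) := by
    intro h hh
    have e : conv u χ (x + h) - conv u χ x - h * conv u χ.deriv x =
        u (reflect χ (x + h) - reflect χ x - (h : ℂ) • reflect χ.deriv x) := by
      simp [conv]
    rw [e]
    refine hC _ _ (by positivity) (fun y hy => ?_) (fun i hi y => ?_)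
    · by_contra hcon
      apply hy
      have h1 : χ (x + h - y) = 0 := by
        by_contra h0
        have := hl _ h0
        have := abs_sub_abs_le_abs_sub y (x + h)
        rw [abs_sub_comm] at this
        linarith [abs_add_le x h]
      have h2 : χ (x - y) = 0 := by
        by_contra h0
        have := hl _ h0
        have := abs_sub_abs_le_abs_sub y x
        rw [abs_sub_comm] at this
        linarith
      have h3 : χ.deriv (x - y) = 0 := by
        by_contra h0
        have := hl' _ h0
        have := abs_sub_abs_le_abs_sub y x
        rw [abs_sub_comm] at this
        linarith
      simp [h1, h2, h3]
    · have c : ∀ ψ : Test, ContDiffAt ℝ i ψ y := fun ψ => contDiffAt_nat ψ.contDiff i y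
      have e2 : ⇑(reflect χ (x + h) - reflect χ x - (h : ℂ) • reflect χ.deriv x) =
          ⇑(reflect χ (x + h)) - ⇑(reflect χ x) - (h : ℂ) • ⇑(reflect χ.deriv x) := rfl
      have c2 : ContDiffAt ℝ i (⇑(reflect χ (x + h)) - ⇑(reflect χ x)) y := (c _).sub (c _)
      have c3 : ContDiffAt ℝ i ((h : ℂ) • ⇑(reflect χ.deriv x)) y :=
        (c (reflect χ.deriv x)).const_smul (h : ℂ)
      rw [e2, iteratedDeriv_sub c2 c3,
        iteratedDeriv_sub (c _) (c _), iteratedDeriv_const_smul_field]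
      simp only [iteratedDeriv_reflect, smul_eq_mul]
      have e3 : iteratedDeriv i χ.deriv = iteratedDeriv (i + 1) χ := by
        rw [Test.coe_deriv, iteratedDeriv_succ']
      rw [e3]
      have e4 : (-1 : ℂ) ^ i * iteratedDeriv i χ (x + h - y) - (-1) ^ i * iteratedDeriv i χ (x - y)
          - h * ((-1) ^ i * iteratedDeriv (i + 1) χ (x - y)) =
          (-1) ^ i * (iteratedDeriv i χ (x - y + h) - iteratedDeriv i χ (x - y)
            - h * iteratedDeriv (i + 1) χ (x - y)) := by
        rw [show x + h - y = x - y + h by ring]; ring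
      rw [e4, norm_mul, norm_pow, norm_neg, norm_one, one_pow, one_mul]
      exact taylor_bound χ i (fun z => hM _ (by omega) z) _ _
  rw [hasDerivAt_iff_isLittleO_nhds_zero]
  have hO : (fun h : ℝ => conv u χ (x + h) - conv u χ x - h • conv u χ.deriv x) =O[𝓝 0]
      fun h : ℝ => h ^ 2 := by
    refine Asymptotics.IsBigO.of_bound (C * M) ?_
    filter_upwards [Metric.closedBall_mem_nhds (0 : ℝ) one_pos] with h hh
    have := key h (by simpa using hh)
    rw [Complex.real_smul, norm_pow, Real.norm_eq_abs, sq_abs, mul_assoc]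
    exact this
  exact hO.trans_isLittleO (Asymptotics.isLittleO_pow_id one_lt_two)

lemma iteratedDeriv_conv (u : Distr) (χ : Test) (k : ℕ) :
    iteratedDeriv k (conv u χ) = conv u (Test.deriv^[k] χ) := by
  induction k with
  | zero => simp
  | succ k ih =>
    rw [iteratedDeriv_succ, ih, Function.iterate_succ_apply']
    funext x
    exact (conv_hasDerivAt u _ x).deriv

lemma contDiff_conv (u : Distr) (χ : Test) : ContDiff ℝ ∞ (conv u χ) := by
  refine contDiff_of_differentiable_iteratedDeriv fun m _ => ?_
  rw [iteratedDeriv_conv]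
  exact fun x => (conv_hasDerivAt u _ x).differentiableAt


/-! ### Models of singularities -/

lemma bddAbove_size (φ : Test) : BddAbove ((fun x : ℝ => |x|) '' Function.support φ) := by
  obtain ⟨l, hl⟩ := φ.exists_support
  exact ⟨l, by rintro _ ⟨x, hx, rfl⟩; exact hl x hx⟩

lemma size_pos (φ : A 0) : 0 < size φ := by
  by_contra h
  have h0 : ∀ x : ℝ, x ≠ 0 → (φ : Test) x = 0 := by
    intro x hx
    by_contra hφ
    have := le_csSup (bddAbove_size φ) ⟨x, hφ, rfl⟩
    exact h ((abs_pos.2 hx).trans_le this)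
  have h1 := φ.2 0 le_rfl
  have h2 : ∫ x : ℝ, (x : ℂ) ^ 0 * (φ : Test) x = ∫ _ : ℝ, (0 : ℂ) := by
    refine integral_congr_ae ?_
    filter_upwards [compl_mem_ae_iff.2 (measure_singleton (0 : ℝ))] with x hx
    simp [h0 x hx]
  rw [h2] at h1
  simp at h1

lemma size_dilate {ε : ℝ} (hε : 0 < ε) (φ : Test) : size (dilate ε φ) = ε * size φ := by
  have : (fun x : ℝ => |x|) '' Function.support (dilate ε φ) =
      ε • ((fun x : ℝ => |x|) '' Function.support φ) := by
    ext z
    simp only [Set.mem_image, Function.mem_support, Set.mem_smul_set, dilate_apply, smul_eq_mul]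
    constructor
    · rintro ⟨x, hx, rfl⟩
      refine ⟨_, ⟨ε⁻¹ * x, right_ne_zero_of_mul hx, rfl⟩, ?_⟩
      rw [abs_mul, abs_of_pos (inv_pos.2 hε)]
      field_simp
    · rintro ⟨_, ⟨x, hx, rfl⟩, rfl⟩
      refine ⟨ε * x, ?_, by rw [abs_mul, abs_of_pos hε]⟩
      have : (ε : ℂ) ≠ 0 := by exact_mod_cast hε.ne'
      rw [inv_mul_cancel_left₀ hε.ne']
      exact mul_ne_zero (inv_ne_zero this) hx
  rw [size, this, Real.sSup_smul_of_nonneg hε.le, smul_eq_mul, size]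

lemma size_scale {ε : ℝ} (hε : 0 < ε) (φ : A 0) : size (scale ε φ) = ε * size φ := by
  rw [scale, dif_pos hε]
  exact size_dilate hε φ

lemma iteratedDeriv_dilate (σ : ℝ) (χ : Test) (m : ℕ) (z : ℝ) :
    iteratedDeriv m (dilate σ χ) z = (σ⁻¹ : ℂ) ^ (m + 1) * iteratedDeriv m χ (σ⁻¹ * z) := by
  have h1 : ⇑(dilate σ χ) = fun x => (σ⁻¹ : ℂ) * (fun y => χ (σ⁻¹ * y)) x := rfl
  have h2 := congrFun (iteratedDeriv_comp_const_smul (n := m)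
    (χ.contDiff.of_le (by exact_mod_cast le_top)) σ⁻¹) z
  rw [h1, iteratedDeriv_const_mul_field]
  simp only [Complex.real_smul] at h2
  rw [h2]
  push_cast
  ring

/-- A profile `D(s, x)`, `s > 0`, of a model of the Dirac function. -/
structure DeltaModel where
  /-- The test function `D(s, ·)`; only `s > 0` matters. -/
  profile : ℝ → Test
  even : ∀ s > 0, ∀ x, profile s (-x) = profile s x
  integral_eq : ∀ s > 0, ∫ x, profile s x = 1
  integral_sq : ∀ s : ℝ, s > 0 → 1 / (s : ℂ) * ∫ x, profile s x ^ 2 = 1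
  /-- The functions `D(s, ·)` remain in a bounded subset of the space of test functions
  as `s → 0₊`: their supports lie in a common interval … -/
  support_bounded : ∃ l : ℝ, ∀ᶠ s in 𝓝[>] (0 : ℝ), ∀ x, profile s x ≠ 0 → |x| ≤ l
  /-- … and each derivative is uniformly bounded. -/
  deriv_bounded : ∀ k : ℕ, ∃ C : ℝ, ∀ᶠ s in 𝓝[>] (0 : ℝ), ∀ x, ‖iteratedDeriv k (profile s) x‖ ≤ C

namespace DeltaModel

/-- The function `D_σ(x) = σ⁻¹ D(σ, σ⁻¹ x)`. -/
def net (D : DeltaModel) (σ : ℝ) : Test := dilate σ (D.profile σ)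

/-- The representative `(φ, x) ↦ (u * D_{s(φ)})(x)`. -/
def rep (D : DeltaModel) (u : Distr) (φ : A 0) (x : ℝ) : ℂ := conv u (D.net (size φ)) x

lemma isModerate_rep (D : DeltaModel) (u : Distr) : IsModerate (D.rep u) := by
  refine ⟨fun φ => contDiff_conv u _, fun K hK p => ?_⟩
  obtain ⟨R, hR⟩ := hK.isBounded.subset_closedBall 0
  obtain ⟨l, hl⟩ := D.support_bounded
  obtain ⟨N, C, hC0, hC⟩ := u.bound (R + |l|)
  choose B hB using D.deriv_bounded
  refine ⟨N + p + 1, fun φ _ => ?_⟩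
  have hs := size_pos φ
  refine ⟨C * ((∑ k ∈ Finset.range (N + p + 1), |B k|) * (size φ)⁻¹ ^ (N + p + 1)), ?_⟩
  have hlim : Tendsto (fun ε : ℝ => ε * size φ) (𝓝[>] 0) (𝓝[>] 0) := by
    refine tendsto_nhdsWithin_iff.2 ⟨?_, ?_⟩
    · have : Tendsto (fun ε : ℝ => ε * size φ) (𝓝 0) (𝓝 (0 * size φ)) :=
        tendsto_id.mul_const _
      rw [zero_mul] at this
      exact this.mono_left nhdsWithin_le_nhds
    · filter_upwards [self_mem_nhdsWithin] with ε hε using mul_pos hε hs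
  have hall : ∀ᶠ s in 𝓝[>] (0 : ℝ), ∀ k ∈ Finset.range (N + p + 1), ∀ x,
      ‖iteratedDeriv k (D.profile s) x‖ ≤ B k :=
    (Finset.eventually_all _).2 fun k _ => hB k
  filter_upwards [hlim.eventually hl, hlim.eventually hall, hlim.eventually eventually_small,
    eventually_small] with ε h1 h2 h3 h4 x hx
  have e : D.rep u (scale ε φ) = conv u (D.net (ε * size φ)) := by
    funext y; rw [rep, size_scale h4.1]
  rw [e, iteratedDeriv_conv]
  set σ := ε * size φ with hσ
  have hinv : 1 ≤ σ⁻¹ := (one_le_inv₀ h3.1).2 h3.2.le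
  have hsum : 0 ≤ ∑ k ∈ Finset.range (N + p + 1), |B k| := Finset.sum_nonneg fun _ _ => abs_nonneg _
  have e2 : C * ((∑ k ∈ Finset.range (N + p + 1), |B k|) * (size φ)⁻¹ ^ (N + p + 1)) *
      ε⁻¹ ^ (N + p + 1) = C * ((∑ k ∈ Finset.range (N + p + 1), |B k|) * σ⁻¹ ^ (N + p + 1)) := by
    rw [hσ, mul_inv, mul_pow]; ring
  rw [e2]
  have hnet : ∀ z, D.net σ z ≠ 0 → |z| ≤ |l| := by
    intro z hz
    have := h1 _ (right_ne_zero_of_mul hz)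
    rw [abs_mul, abs_of_pos (inv_pos.2 h3.1)] at this
    calc |z| ≤ σ⁻¹ * |z| := le_mul_of_one_le_left (abs_nonneg _) hinv
      _ ≤ l := this
      _ ≤ |l| := le_abs_self _
  refine hC _ _ (by positivity) (fun y hy => ?_) (fun i hi y => ?_)
  · have h5 := Test.support_deriv_iterate _ hnet p _ hy
    have h6 : |x| ≤ R := by simpa using hR hx
    have h7 := abs_sub_abs_le_abs_sub y x
    rw [abs_sub_comm] at h7
    linarith
  · rw [iteratedDeriv_reflect, norm_mul, norm_pow, norm_neg, norm_one, one_pow, one_mul,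
      ← Test.coe_deriv_iterate, ← Function.iterate_add_apply, Test.coe_deriv_iterate, net,
      iteratedDeriv_dilate, norm_mul, norm_pow, norm_inv, Complex.norm_real, Real.norm_eq_abs,
      abs_of_pos h3.1, mul_comm]
    have hmem : i + p ∈ Finset.range (N + p + 1) := Finset.mem_range.2 (by omega)
    gcongr
    · exact ((h2 _ hmem _).trans (le_abs_self _)).trans
        (Finset.single_le_sum (f := fun k => |B k|) (fun _ _ => abs_nonneg _) hmem)

/-- The model in the Colombeau algebra of the distribution `u`, obtained by convolution
with `D`. -/
def model (D : DeltaModel) (u : Distr) : G := G.mk (D.rep u) (D.isModerate_rep u)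

/-- A real-valued test function, regarded as complex-valued. -/
def ofRealTest (f : 𝓓((⊤ : TopologicalSpace.Opens ℝ), ℝ)) : Test :=
  TestFunction.postcompCLM Complex.ofRealCLM f

@[simp] lemma ofRealTest_apply (f : 𝓓((⊤ : TopologicalSpace.Opens ℝ), ℝ)) (x : ℝ) :
    ofRealTest f x = (f x : ℂ) := rfl

/-- The profile `D(s, x) = f(x) + λ_s g(x)`, where `f` and `g` are real-valued even test functions
with disjoint supports, `∫ f = 1`, `∫ g = 0` and `λ_s² = (s - ∫ f²) / ∫ g²`. -/
def ofPair (f g : 𝓓((⊤ : TopologicalSpace.Opens ℝ), ℝ)) (lam : ℝ → ℂ)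
    (hf : ∀ x, f (-x) = f x) (hg : ∀ x, g (-x) = g x)
    (hfg : Disjoint (Function.support f) (Function.support g))
    (hf1 : ∫ x, f x = 1) (hg0 : ∫ x, g x = 0) (hgne : g ≠ 0)
    (hlam : ∀ s > 0, lam s ^ 2 = (((s - ∫ x, f x ^ 2) / ∫ x, g x ^ 2 : ℝ) : ℂ)) : DeltaModel where
  profile s := ofRealTest f + lam s • ofRealTest g
  even s _ x := by simp [hf, hg]
  integral_eq s _ := by
    have i1 : Integrable (fun x => (f x : ℂ)) :=
      (f.continuous.integrable_of_hasCompactSupport f.hasCompactSupport).ofReal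
    have i2 : Integrable (fun x => (g x : ℂ)) :=
      (g.continuous.integrable_of_hasCompactSupport g.hasCompactSupport).ofReal
    have e : ∀ x, (ofRealTest f + lam s • ofRealTest g) x = (f x : ℂ) + lam s * (g x : ℂ) :=
      fun x => by simp
    simp_rw [e]
    rw [integral_add i1 (i2.const_mul _), integral_const_mul, integral_complex_ofReal,
      integral_complex_ofReal, hf1, hg0]
    simp
  integral_sq s hs := by
    have sqc : ∀ f : 𝓓((⊤ : TopologicalSpace.Opens ℝ), ℝ), HasCompactSupport (fun x => f x ^ 2) :=
      fun f => f.hasCompactSupport.comp_left (g := fun y : ℝ => y ^ 2) (by simp)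
    have i : ∀ f : 𝓓((⊤ : TopologicalSpace.Opens ℝ), ℝ), Integrable (fun x => ((f x ^ 2 : ℝ) : ℂ)) :=
      fun f => ((f.continuous.pow 2).integrable_of_hasCompactSupport (sqc f)).ofReal
    have e : ∀ x, (ofRealTest f + lam s • ofRealTest g) x ^ 2 =
        ((f x ^ 2 : ℝ) : ℂ) + lam s ^ 2 * ((g x ^ 2 : ℝ) : ℂ) := by
      intro x
      have h0 : (f x : ℂ) * g x = 0 := by
        by_contra h
        exact Set.disjoint_left.1 hfg
          (show f x ≠ 0 from fun h' => h (by simp [h'])) (fun h' => h (by simp [h']))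
      have : (ofRealTest f + lam s • ofRealTest g) x = (f x : ℂ) + lam s * (g x : ℂ) := by simp
      rw [this]
      push_cast
      linear_combination 2 * lam s * h0
    have hpos : 0 < ∫ x, g x ^ 2 := by
      obtain ⟨x, hx⟩ := DFunLike.ne_iff.1 hgne
      exact (g.continuous.pow 2).integral_pos_of_hasCompactSupport_nonneg_nonzero (sqc g)
        (fun _ => sq_nonneg _) (x := x) (pow_ne_zero 2 hx)
    simp_rw [e]
    rw [integral_add (i f) ((i g).const_mul _), integral_const_mul, integral_complex_ofReal,
      integral_complex_ofReal, hlam s hs]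
    norm_cast
    have := hpos.ne'
    have := hs.ne'
    field_simp
    ring
  support_bounded := by
    obtain ⟨l₁, h₁⟩ := (ofRealTest f).exists_support
    obtain ⟨l₂, h₂⟩ := (ofRealTest g).exists_support
    refine ⟨max l₁ l₂, ?_⟩
    filter_upwards with s x hx
    by_contra h
    rw [not_le, max_lt_iff] at h
    apply hx
    have e₁ : ofRealTest f x = 0 := by by_contra h'; exact absurd (h₁ x h') (not_le.2 h.1)
    have e₂ : ofRealTest g x = 0 := by by_contra h'; exact absurd (h₂ x h') (not_le.2 h.2)
    change ofRealTest f x + lam s • ofRealTest g x = 0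
    simp [e₁, e₂]
  deriv_bounded k := by
    obtain ⟨C₁, -, h₁⟩ := (ofRealTest f).exists_bound k
    obtain ⟨C₂, h0, h₂⟩ := (ofRealTest g).exists_bound k
    set a := ∫ x, f x ^ 2
    set b := ∫ x, g x ^ 2
    refine ⟨C₁ + (1 + (1 + |a|) / |b|) * C₂, ?_⟩
    filter_upwards [eventually_small] with s ⟨hs, hs1⟩ x
    have hl : ‖lam s‖ ≤ 1 + (1 + |a|) / |b| := by
      have h3 : ‖lam s‖ ^ 2 ≤ (1 + |a|) / |b| := by
        rw [← norm_pow, hlam s hs, Complex.norm_real, Real.norm_eq_abs, abs_div]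
        gcongr
        refine (abs_sub _ _).trans ?_
        rw [abs_of_pos hs]
        gcongr
      nlinarith [sq_nonneg (‖lam s‖ - 1), norm_nonneg (lam s)]
    have e : ⇑(ofRealTest f + lam s • ofRealTest g) =
        ⇑(ofRealTest f) + lam s • ⇑(ofRealTest g) := rfl
    have c₂ : ContDiffAt ℝ k (lam s • ⇑(ofRealTest g)) x :=
      (contDiffAt_nat (ofRealTest g).contDiff k x).const_smul (lam s)
    rw [e, iteratedDeriv_add (contDiffAt_nat (ofRealTest f).contDiff k x) c₂,
      iteratedDeriv_const_smul_field]
    refine norm_add_le_of_le (h₁ x) ?_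
    rw [norm_smul]
    exact mul_le_mul hl (h₂ x) (norm_nonneg _) (by positivity)

end DeltaModel

end

end Colombeau

/-!
At scale `σ` the representatives of both products are `σ⁻² f(x / σ)` with `f` built from the
profile `d = D(σ, ·)`: under dilation the logarithmic kernels produce terms with `log σ`, and these
cancel because `θ * d' = d`. Such a net tends to `c δ` once `f` has integral `c σ` and first moment
`0`. Both moments of the first product come from the identity
`P' = f + d² - d · (pv(1/x) * d)` for an explicit compactly supported `P`: the kernel of `pv(1/x)`
is antisymmetric, so the last term has integral `0`, and `x · pv(1/x) = 1` makes its first moment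
`(∫ d)² / 2`, which is also `∫ P`. Hence the moments of `f` are those of `-d²`, and `∫ d² = σ`.
The second product is the mirror image of the first.
-/

namespace Colombeau

section Integration

lemma integrable_of_support {f : ℝ → ℂ} (hf : Continuous f) {l : ℝ}
    (hl : ∀ x, f x ≠ 0 → |x| ≤ l) : Integrable f :=
  hf.integrable_of_hasCompactSupport
    (HasCompactSupport.of_support_subset_isCompact (isCompact_Icc (a := -l) (b := l))
      fun x hx => abs_le.1 (hl x hx))

lemma integral_eq_zero_of_odd {E : Type*} [NormedAddCommGroup E] [NormedSpace ℝ E] {f : ℝ → E}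
    (hf : ∀ x, f (-x) = -f x) : ∫ x, f x = 0 := by
  have h := integral_neg_eq_self f volume
  simp only [hf, integral_neg] at h
  have := IsAddTorsionFree.of_isTorsionFree ℝ E
  exact self_eq_neg.1 h.symm

lemma integral_of_hasDerivAt_off_countable_of_tendsto {E : Type*} [NormedAddCommGroup E]
    [NormedSpace ℝ E] [CompleteSpace E] {f f' : ℝ → E} {s : Set ℝ} {m n : E} (hs : s.Countable)
    (hf : Continuous f) (hderiv : ∀ x ∉ s, HasDerivAt f (f' x) x) (hf' : Integrable f')
    (hbot : Tendsto f atBot (𝓝 m)) (htop : Tendsto f atTop (𝓝 n)) : ∫ x, f' x = n - m := by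
  refine tendsto_nhds_unique
    (intervalIntegral_tendsto_integral hf' tendsto_neg_atTop_atBot tendsto_id) ?_
  refine (htop.sub (hbot.comp tendsto_neg_atTop_atBot)).congr fun r => ?_
  exact (integral_eq_of_hasDerivAt_off_countable f f' hs hf.continuousOn
    (fun x hx => hderiv x hx.2) hf'.intervalIntegrable).symm

lemma norm_integral_mul_le {f η : ℝ → ℂ} {l M B : ℝ} (hl : 0 ≤ l)
    (hf : ∀ x, f x ≠ 0 → |x| ≤ l) (hM : ∀ x, ‖f x‖ ≤ M) (hη : ∀ x, |x| ≤ l → ‖η x‖ ≤ B) :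
    ‖∫ x, f x * η x‖ ≤ M * B * (2 * l) := by
  have hIcc : ∫ x in Set.Icc (-l) l, f x * η x = ∫ x, f x * η x := by
    refine setIntegral_eq_integral_of_forall_compl_eq_zero fun x hx => ?_
    by_contra h
    exact hx (abs_le.1 (hf x (left_ne_zero_of_mul h)))
  have hbound : ∀ x ∈ Set.Icc (-l) l, ‖f x * η x‖ ≤ M * B := fun x hx =>
    norm_mul_le_of_le (hM x) (hη x (abs_le.2 hx))
  have hvol : volume.real (Set.Icc (-l) l) = 2 * l := by
    rw [Real.volume_real_Icc_of_le (by linarith)]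
    ring
  rw [← hIcc, ← hvol]
  exact norm_setIntegral_le_of_norm_le_const (by simp) hbound

lemma locallyIntegrable_comp_neg {f : ℝ → ℂ} (hf : LocallyIntegrable f) :
    LocallyIntegrable fun x => f (-x) := by
  refine (locallyIntegrable_map_homeomorph (Homeomorph.neg ℝ)).1 ?_
  rwa [Homeomorph.coe_neg, show Measure.map Neg.neg (volume : Measure ℝ) = volume from
    Measure.map_neg_eq_self volume]

end Integration

section TestFunctions

namespace Test

lemma integrable (χ : Test) : Integrable χ :=
  χ.continuous.integrable_of_hasCompactSupport χ.hasCompactSupport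

lemma integrable_mul (χ : Test) {f : ℝ → ℂ} (hf : LocallyIntegrable f) :
    Integrable fun x => χ x * f x := by
  simpa only [smul_eq_mul] using
    hf.integrable_smul_left_of_hasCompactSupport χ.continuous χ.hasCompactSupport

lemma integrable_mul_conv (χ : Test) (u : Distr) (ψ : Test) :
    Integrable fun x => χ x * conv u ψ x :=
  χ.integrable_mul (contDiff_conv u ψ).continuous.locallyIntegrable

lemma integrable_sq (χ : Test) : Integrable fun x => χ x ^ 2 := by
  simpa only [sq] using χ.integrable_mul χ.continuous.locallyIntegrable

lemma hasDerivAt (χ : Test) (x : ℝ) : HasDerivAt χ (χ.deriv x) x := by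
  rw [coe_deriv]
  exact (χ.contDiff.differentiable (by simp) x).hasDerivAt

lemma integral_deriv (χ : Test) : ∫ x, χ.deriv x = 0 :=
  integral_eq_zero_of_hasDerivAt_of_integrable χ.hasDerivAt χ.deriv.integrable χ.integrable

lemma deriv_neg (χ : Test) : (-χ).deriv = -χ.deriv := map_neg _ χ

lemma deriv_smul (c : ℂ) (χ : Test) : (c • χ).deriv = c • χ.deriv := map_smul _ c χ

lemma deriv_reflect (χ : Test) (x : ℝ) : (reflect χ x).deriv = -reflect χ.deriv x := by
  ext y
  have h := iteratedDeriv_reflect χ x 1 y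
  simp only [iteratedDeriv_one, pow_one, neg_one_mul, ← coe_deriv] at h
  exact h

lemma deriv_dilate (σ : ℝ) (χ : Test) : (dilate σ χ).deriv = (σ⁻¹ : ℂ) • dilate σ χ.deriv := by
  ext y
  have h := iteratedDeriv_dilate σ χ 1 y
  simp only [iteratedDeriv_one, ← coe_deriv] at h
  change _ = (σ⁻¹ : ℂ) * ((σ⁻¹ : ℂ) * χ.deriv (σ⁻¹ * y))
  rw [h]
  ring

/-- The test function `x ↦ x χ(x)`, through which first moments are expressed. -/
noncomputable def mulX (χ : Test) : Test :=
  Test.of (fun x => (x : ℂ) * χ x) (Complex.ofRealCLM.contDiff.mul χ.contDiff)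
    χ.hasCompactSupport.mul_left

@[simp] lemma mulX_apply (χ : Test) (x : ℝ) : χ.mulX x = x * χ x := rfl

end Test

end TestFunctions

section Convolution

lemma conv_smul (u : Distr) (c : ℂ) (χ : Test) (x : ℝ) :
    conv u (c • χ) x = c * conv u χ x := map_smul u c (reflect χ x)

lemma conv_deriv (u : Distr) (χ : Test) (x : ℝ) : conv u.deriv χ x = conv u χ.deriv x := by
  change -u (reflect χ x).deriv = u (reflect χ.deriv x)
  rw [Test.deriv_reflect, map_neg, neg_neg]

lemma conv_delta (χ : Test) (x : ℝ) : conv delta χ x = χ x :=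
  congrArg χ (sub_zero x)

lemma continuous_conv (u : Distr) (χ : Test) : Continuous (conv u χ) :=
  (contDiff_conv u χ).continuous

lemma mul_conv (u : Distr) (χ : Test) (x : ℝ) :
    x * conv u χ x = conv u χ.mulX x + u (reflect χ x).mulX := by
  have h : (x : ℂ) • reflect χ x = reflect χ.mulX x + (reflect χ x).mulX := by
    ext y
    change (x : ℂ) * χ (x - y) = ((x - y : ℝ) : ℂ) * χ (x - y) + y * χ (x - y)
    push_cast
    ring
  rw [conv, conv, ← smul_eq_mul, ← map_smul, h, map_add]

lemma exists_bound_conv (u : Distr) {ι : Type*} {F : Filter ι} {d : ι → Test} {l : ℝ}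
    (hl : ∀ᶠ i in F, ∀ x, d i x ≠ 0 → |x| ≤ l)
    (hB : ∀ k : ℕ, ∃ C : ℝ, ∀ᶠ i in F, ∀ x, ‖iteratedDeriv k (d i) x‖ ≤ C) (m : ℕ) (R : ℝ) :
    ∃ C : ℝ, ∀ᶠ i in F, ∀ x, |x| ≤ R → ‖conv u (Test.deriv^[m] (d i)) x‖ ≤ C := by
  obtain ⟨N, C, -, hC⟩ := u.bound (R + l)
  choose B hB using hB
  have hall : ∀ᶠ i in F, ∀ k ∈ Finset.range (N + m + 1), ∀ x,
      ‖iteratedDeriv k (d i) x‖ ≤ B k := (Finset.eventually_all _).2 fun k _ => hB k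
  refine ⟨C * ∑ k ∈ Finset.range (N + m + 1), |B k|, ?_⟩
  filter_upwards [hl, hall] with i hsupp hbound x hx
  refine hC _ _ (Finset.sum_nonneg fun _ _ => abs_nonneg _) (fun y hy => ?_) (fun j hj y => ?_)
  · have hxy : |x - y| ≤ l := Test.support_deriv_iterate _ hsupp m _ hy
    calc |y| = |x - (x - y)| := by rw [sub_sub_cancel]
      _ ≤ |x| + |x - y| := abs_sub _ _
      _ ≤ R + l := add_le_add hx hxy
  · have hmem : j + m ∈ Finset.range (N + m + 1) := Finset.mem_range.2 (by omega)
    rw [iteratedDeriv_reflect, norm_mul, norm_pow, norm_neg, norm_one, one_pow, one_mul,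
      ← Test.coe_deriv_iterate, ← Function.iterate_add_apply, Test.coe_deriv_iterate]
    calc _ ≤ B (j + m) := hbound _ hmem _
      _ ≤ |B (j + m)| := le_abs_self _
      _ ≤ _ := Finset.single_le_sum (f := fun k => |B k|) (fun _ _ => abs_nonneg _) hmem

variable {f g : ℝ → ℂ}

lemma Distr.ofFun_apply (hf : LocallyIntegrable f) (ψ : Test) :
    Distr.ofFun f ψ = ∫ x, ψ x * f x := by
  rw [Distr.ofFun, TestFunction.integralAgainstBilinCLM_eq_integral (hf.locallyIntegrableOn _)]
  rfl

lemma conv_ofFun (hf : LocallyIntegrable f) (χ : Test) (x : ℝ) :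
    conv (Distr.ofFun f) χ x = ∫ y, χ (x - y) * f y :=
  Distr.ofFun_apply hf _

lemma integrable_conv (hf : LocallyIntegrable f) (χ : Test) (x : ℝ) :
    Integrable fun y => χ (x - y) * f y :=
  (reflect χ x).integrable_mul hf

lemma conv_ofFun_add (hf : LocallyIntegrable f) (hg : LocallyIntegrable g) (χ : Test) (x : ℝ) :
    conv (Distr.ofFun (f + g)) χ x = conv (Distr.ofFun f) χ x + conv (Distr.ofFun g) χ x := by
  rw [conv_ofFun hf, conv_ofFun hg, conv_ofFun (hf.add hg),
    ← integral_add (integrable_conv hf χ x) (integrable_conv hg χ x)]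
  simp only [Pi.add_apply, mul_add]

lemma conv_ofFun_eq_zero (hf : LocallyIntegrable f) {χ : Test} {l x : ℝ}
    (hl : ∀ y, χ y ≠ 0 → |y| ≤ l) (hx : ∀ y, f y ≠ 0 → l < |x - y|) :
    conv (Distr.ofFun f) χ x = 0 := by
  rw [conv_ofFun hf]
  refine integral_eq_zero_of_ae (.of_forall fun y => ?_)
  by_contra h
  exact (hl _ (left_ne_zero_of_mul h)).not_gt (hx y (right_ne_zero_of_mul h))

lemma conv_ofFun_comp_neg (hf : LocallyIntegrable f) (χ : Test) (x : ℝ) :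
    conv (Distr.ofFun fun y => f (-y)) χ x = conv (Distr.ofFun f) (reflect χ 0) (-x) := by
  rw [conv_ofFun hf, conv_ofFun (locallyIntegrable_comp_neg hf), ← integral_neg_eq_self]
  refine integral_congr_ae (.of_forall fun y => ?_)
  simp only [reflect_apply, neg_neg]
  congr 2
  ring

lemma conv_ofFun_dilate (hf : LocallyIntegrable f) (χ : Test) {σ : ℝ} (hσ : 0 < σ) (t : ℝ) :
    conv (Distr.ofFun f) (dilate σ χ) (σ * t) = ∫ y, χ (t - y) * f (σ * y) := by
  have hσ' : (σ⁻¹ : ℂ) ≠ 0 := inv_ne_zero (by exact_mod_cast hσ.ne')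
  have hscale : ∀ y : ℝ, dilate σ χ (σ * t - σ * y) * f (σ * y) =
      (σ⁻¹ : ℂ) * (χ (t - y) * f (σ * y)) := fun y => by
    rw [dilate_apply, ← mul_sub, inv_mul_cancel_left₀ hσ.ne', mul_assoc]
  have h := Measure.integral_comp_mul_left (fun y => dilate σ χ (σ * t - y) * f y) σ
  simp_rw [hscale] at h
  rw [integral_const_mul, abs_of_pos (inv_pos.2 hσ), Complex.real_smul, Complex.ofReal_inv] at h
  rw [conv_ofFun hf]
  exact (mul_left_cancel₀ hσ' h).symm

lemma conv_ofFun_dilate_of_comp_mul (hf : LocallyIntegrable f) (hg : LocallyIntegrable g)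
    {σ : ℝ} (hσ : 0 < σ) {a : ℂ} (hfg : ∀ y, f (σ * y) = f y + a * g y) (χ : Test) (t : ℝ) :
    conv (Distr.ofFun f) (dilate σ χ) (σ * t) =
      conv (Distr.ofFun f) χ t + a * conv (Distr.ofFun g) χ t := by
  rw [conv_ofFun_dilate hf χ hσ, conv_ofFun hf, conv_ofFun hg, ← integral_const_mul,
    ← integral_add (integrable_conv hf χ t) ((integrable_conv hg χ t).const_mul a)]
  simp only [hfg, mul_add, mul_left_comm a]

lemma integrable_mul_kernel (hf : LocallyIntegrable f) (χ ψ : Test) :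
    Integrable (Function.uncurry fun x y : ℝ => χ x * (ψ (x - y) * f y))
      (volume.prod volume) := by
  obtain ⟨l, hl⟩ := χ.exists_support
  obtain ⟨m, hm⟩ := ψ.exists_support
  obtain ⟨C, hC0, hC⟩ := ψ.exists_bound 0
  have hint : IntegrableOn f (Set.Icc (-(l + m)) (l + m)) :=
    hf.integrableOn_isCompact isCompact_Icc
  have hprod := χ.integrable.mul_prod (hint.integrable_indicator measurableSet_Icc)
  refine (hprod.norm.const_mul C).mono' ?_ (.of_forall fun ⟨x, y⟩ => ?_)
  · exact (χ.continuous.comp continuous_fst).aestronglyMeasurable.mul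
      ((ψ.continuous.comp (continuous_fst.sub continuous_snd)).aestronglyMeasurable.mul
        hf.aestronglyMeasurable.comp_snd)
  simp only [Function.uncurry_apply_pair]
  by_cases h : χ x = 0 ∨ ψ (x - y) = 0
  · have hzero : χ x * (ψ (x - y) * f y) = 0 := by rcases h with h | h <;> simp [h]
    rw [hzero, norm_zero]
    positivity
  obtain ⟨hx, hxy⟩ := not_or.1 h
  have hy : y ∈ Set.Icc (-(l + m)) (l + m) := by
    have h₁ := abs_le.1 (hl x hx)
    have h₂ := abs_le.1 (hm _ hxy)
    constructor <;> linarith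
  have hψ : ‖ψ (x - y)‖ ≤ C := by simpa only [iteratedDeriv_zero] using hC (x - y)
  rw [Set.indicator_of_mem hy, norm_mul, norm_mul, norm_mul]
  calc ‖χ x‖ * (‖ψ (x - y)‖ * ‖f y‖) ≤ ‖χ x‖ * (C * ‖f y‖) := by gcongr
    _ = C * (‖χ x‖ * ‖f y‖) := by ring

lemma integral_mul_conv_ofFun (hf : LocallyIntegrable f) (χ ψ : Test) :
    ∫ x, χ x * conv (Distr.ofFun f) ψ x = ∫ y, ∫ x, χ x * (ψ (x - y) * f y) := by
  rw [← integral_integral_swap (integrable_mul_kernel hf χ ψ)]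
  simp only [conv_ofFun hf, integral_const_mul]

lemma integral_mul_conv_ofFun_comm (hf : LocallyIntegrable f) (χ ψ : Test) :
    ∫ x, χ x * conv (Distr.ofFun f) ψ x =
      ∫ x, ψ x * conv (Distr.ofFun fun y => f (-y)) χ x := by
  rw [integral_mul_conv_ofFun hf, integral_mul_conv_ofFun (locallyIntegrable_comp_neg hf),
    ← integral_neg_eq_self]
  congr 1 with y
  rw [← integral_sub_right_eq_self _ y]
  simp only [sub_neg_eq_add, sub_add_cancel, mul_left_comm]

end Convolution

section Heaviside

lemma heavisideRefFun_eq_comp_neg : heavisideRefFun = fun y => heavisideFun (-y) := by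
  funext y
  simp [heavisideFun, heavisideRefFun]

lemma conv_heaviside_dilate (χ : Test) {σ : ℝ} (hσ : 0 < σ) (t : ℝ) :
    conv heaviside (dilate σ χ) (σ * t) = conv heaviside χ t := by
  rw [heaviside, conv_ofFun_dilate locallyIntegrable_heavisideFun χ hσ,
    conv_ofFun locallyIntegrable_heavisideFun]
  simp only [heavisideFun, mul_pos_iff_of_pos_left hσ]

lemma conv_heaviside_eq_zero {χ : Test} {l : ℝ} (hl : ∀ x, χ x ≠ 0 → |x| ≤ l) {x : ℝ}
    (hx : x < -l) : conv heaviside χ x = 0 := by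
  refine conv_ofFun_eq_zero locallyIntegrable_heavisideFun hl fun y hy => ?_
  have hy : 0 < y := by simpa [heavisideFun] using hy
  exact lt_abs.2 (Or.inr (by linarith))

lemma conv_heaviside_eq_setIntegral_Iic (χ : Test) (x : ℝ) :
    conv heaviside χ x = ∫ y in Set.Iic x, χ y := by
  rw [heaviside, conv_ofFun locallyIntegrable_heavisideFun, integral_Iic_eq_integral_Iio,
    ← integral_indicator measurableSet_Iio, ← integral_sub_left_eq_self _ volume x]
  congr 1 with y
  simp [heavisideFun, Set.indicator_apply]

lemma conv_heaviside_add_conv_heavisideRef (χ : Test) (x : ℝ) :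
    conv heaviside χ x + conv heavisideRef χ x = ∫ y, χ y := by
  rw [heaviside, heavisideRef,
    ← conv_ofFun_add locallyIntegrable_heavisideFun locallyIntegrable_heavisideRefFun,
    conv_ofFun (locallyIntegrable_heavisideFun.add locallyIntegrable_heavisideRefFun),
    ← integral_sub_left_eq_self χ volume x]
  refine integral_congr_ae ?_
  filter_upwards [compl_mem_ae_iff.2 (measure_singleton (0 : ℝ))] with y hy
  rcases lt_or_gt_of_ne hy with hy | hy <;>
    simp [heavisideFun, heavisideRefFun, hy, hy.not_gt]

lemma conv_heaviside_deriv (χ : Test) (x : ℝ) : conv heaviside χ.deriv x = χ x := by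
  rw [conv_heaviside_eq_setIntegral_Iic, Test.coe_deriv]
  exact HasCompactSupport.integral_Iic_deriv_eq (χ.contDiff.of_le (by simp)) χ.hasCompactSupport x

lemma conv_heavisideRef_deriv (χ : Test) (x : ℝ) : conv heavisideRef χ.deriv x = -χ x := by
  have h := conv_heaviside_add_conv_heavisideRef χ.deriv x
  rw [χ.integral_deriv, conv_heaviside_deriv] at h
  exact (neg_eq_of_add_eq_zero_right h).symm

lemma conv_heaviside_hasDerivAt (χ : Test) (x : ℝ) : HasDerivAt (conv heaviside χ) (χ x) x := by
  simpa only [conv_heaviside_deriv] using conv_hasDerivAt heaviside χ x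

lemma integral_mul_conv_heaviside (χ : Test) :
    ∫ x, χ x * conv heaviside χ x = (∫ x, χ x) ^ 2 / 2 := by
  have hsymm : ∫ x, χ x * conv heaviside χ x = ∫ x, χ x * conv heavisideRef χ x := by
    rw [heaviside, heavisideRef, heavisideRefFun_eq_comp_neg]
    exact integral_mul_conv_ofFun_comm locallyIntegrable_heavisideFun χ χ
  have hsum : (∫ x, χ x * conv heaviside χ x) + ∫ x, χ x * conv heavisideRef χ x =
      (∫ x, χ x) ^ 2 := by
    rw [← integral_add (χ.integrable_mul_conv _ _) (χ.integrable_mul_conv _ _)]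
    simp only [← mul_add, conv_heaviside_add_conv_heavisideRef, integral_mul_const, sq]
  linear_combination (hsum + hsymm) / 2

end Heaviside

section Logarithm

lemma lnMinusFun_eq_comp_neg : lnMinusFun = fun y => lnPlusFun (-y) := by
  funext y
  simp [lnPlusFun, lnMinusFun]

lemma lnPlusFun_eq_comp_neg : lnPlusFun = fun y => lnMinusFun (-y) := by
  funext y
  simp [lnPlusFun, lnMinusFun]

lemma lnPlusFun_mul {σ : ℝ} (hσ : 0 < σ) (y : ℝ) :
    lnPlusFun (σ * y) = lnPlusFun y + Real.log σ * heavisideFun y := by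
  by_cases hy : 0 < y
  · simp [lnPlusFun, heavisideFun, hσ, hy, Real.log_mul hσ.ne' hy.ne', add_comm]
  · simp [lnPlusFun, heavisideFun, hσ, hy]

lemma lnMinusFun_mul {σ : ℝ} (hσ : 0 < σ) (y : ℝ) :
    lnMinusFun (σ * y) = lnMinusFun y + Real.log σ * heavisideRefFun y := by
  simp only [lnMinusFun_eq_comp_neg, heavisideRefFun_eq_comp_neg, ← mul_neg, lnPlusFun_mul hσ]

lemma conv_lnPlus_dilate (χ : Test) {σ : ℝ} (hσ : 0 < σ) (t : ℝ) :
    conv lnPlus (dilate σ χ) (σ * t) = conv lnPlus χ t + Real.log σ * conv heaviside χ t :=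
  conv_ofFun_dilate_of_comp_mul locallyIntegrable_lnPlusFun locallyIntegrable_heavisideFun hσ
    (lnPlusFun_mul hσ) χ t

lemma conv_lnMinus_dilate (χ : Test) {σ : ℝ} (hσ : 0 < σ) (t : ℝ) :
    conv lnMinus (dilate σ χ) (σ * t) =
      conv lnMinus χ t + Real.log σ * conv heavisideRef χ t :=
  conv_ofFun_dilate_of_comp_mul locallyIntegrable_lnMinusFun locallyIntegrable_heavisideRefFun hσ
    (lnMinusFun_mul hσ) χ t

lemma conv_lnMinus_eq_zero {χ : Test} {l : ℝ} (hl : ∀ x, χ x ≠ 0 → |x| ≤ l) {x : ℝ}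
    (hx : l < x) : conv lnMinus χ x = 0 := by
  refine conv_ofFun_eq_zero locallyIntegrable_lnMinusFun hl fun y hy => ?_
  have hy : y < 0 := (ite_ne_right_iff.1 hy).1
  exact lt_abs.2 (Or.inl (by linarith))

lemma integral_mul_conv_lnPlus (χ ψ : Test) :
    ∫ x, χ x * conv lnPlus ψ x = ∫ x, ψ x * conv lnMinus χ x := by
  rw [lnPlus, lnMinus, lnMinusFun_eq_comp_neg]
  exact integral_mul_conv_ofFun_comm locallyIntegrable_lnPlusFun χ ψ

/-- The distribution `ln |x|`; its derivative is the principal value of `1 / x`. -/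
noncomputable def lnAbs : Distr := Distr.ofFun fun x => (Real.log x : ℂ)

lemma conv_lnMinus_add_conv_lnPlus (χ : Test) (x : ℝ) :
    conv lnMinus χ x + conv lnPlus χ x = conv lnAbs χ x := by
  rw [lnMinus, lnPlus, lnAbs,
    ← conv_ofFun_add locallyIntegrable_lnMinusFun locallyIntegrable_lnPlusFun]
  congr 2 with y
  rcases lt_trichotomy y 0 with hy | rfl | hy
  · simp [lnMinusFun, lnPlusFun, hy, hy.not_gt]
  · simp [lnMinusFun, lnPlusFun]
  · simp [lnMinusFun, lnPlusFun, hy, hy.not_gt]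

lemma lnAbs_deriv_mulX (ψ : Test) : lnAbs.deriv ψ.mulX = ∫ x, ψ x := by
  have hcont : Continuous fun x : ℝ => ψ x * (x * Real.log x : ℂ) := by
    have h := Complex.continuous_ofReal.comp Real.continuous_mul_log
    simp only [Function.comp_def, Complex.ofReal_mul] at h
    exact ψ.continuous.mul h
  have hzero := ψ.hasCompactSupport.mul_right (f' := fun x : ℝ => (x * Real.log x : ℂ))
    |>.is_zero_at_infty
  have hint := ψ.mulX.deriv.integrable_mul locallyIntegrable_log
  have hderiv : ∀ x ∉ ({0} : Set ℝ), HasDerivAt (fun x : ℝ => ψ x * (x * Real.log x : ℂ))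
      (ψ.mulX.deriv x * Real.log x + ψ x) x := by
    intro x hx
    have h := (ψ.mulX.hasDerivAt x).mul (Real.hasDerivAt_log hx).ofReal_comp
    refine (h.congr_deriv ?_).congr_of_eventuallyEq (.of_forall fun y => ?_)
    · have hx' : (x : ℂ) ≠ 0 := by exact_mod_cast hx
      simp only [Test.mulX_apply, Complex.ofReal_inv]
      field_simp
    · simp only [Pi.mul_apply, Test.mulX_apply]
      ring
  have h := integral_of_hasDerivAt_off_countable_of_tendsto (Set.countable_singleton 0) hcont
    hderiv (hint.add ψ.integrable) (hzero.mono_left atBot_le_cocompact)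
    (hzero.mono_left atTop_le_cocompact)
  rw [integral_add hint ψ.integrable, sub_zero] at h
  change -lnAbs ψ.mulX.deriv = _
  rw [lnAbs, Distr.ofFun_apply locallyIntegrable_log]
  exact neg_eq_of_add_eq_zero_right h

lemma mul_conv_lnAbs_deriv (χ : Test) (x : ℝ) :
    x * conv lnAbs.deriv χ x = conv lnAbs.deriv χ.mulX x + ∫ y, χ y := by
  rw [mul_conv, lnAbs_deriv_mulX]
  simp only [reflect_apply, integral_sub_left_eq_self χ volume x]

lemma integral_deriv_mul_conv (u : Distr) (χ ψ : Test) :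
    ∫ x, χ.deriv x * conv u ψ x = -∫ x, χ x * conv u.deriv ψ x := by
  simp only [conv_deriv]
  rw [integral_mul_deriv_eq_deriv_mul_of_integrable (fun x _ => χ.hasDerivAt x)
    (fun x _ => conv_hasDerivAt u ψ x) (χ.integrable_mul_conv _ _)
    (χ.deriv.integrable_mul_conv _ _) (χ.integrable_mul_conv _ _), neg_neg]

lemma integral_mul_conv_lnAbs_deriv_antisymm (χ ψ : Test) :
    ∫ x, χ x * conv lnAbs.deriv ψ x = -∫ x, ψ x * conv lnAbs.deriv χ x := by
  have heven : (fun y : ℝ => (Real.log (-y) : ℂ)) = fun y => (Real.log y : ℂ) := by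
    simp only [Real.log_neg_eq_log]
  have hsymm := integral_mul_conv_ofFun_comm locallyIntegrable_log χ ψ.deriv
  rw [heven] at hsymm
  rw [← integral_deriv_mul_conv]
  simp only [conv_deriv]
  exact hsymm

lemma integral_mul_conv_lnAbs_deriv_self (χ : Test) :
    ∫ x, χ x * conv lnAbs.deriv χ x = 0 :=
  self_eq_neg.1 (integral_mul_conv_lnAbs_deriv_antisymm χ χ)

lemma integral_mulX_mul_conv_lnAbs_deriv_self (χ : Test) :
    ∫ x, χ.mulX x * conv lnAbs.deriv χ x = (∫ x, χ x) ^ 2 / 2 := by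
  have hcomm : ∫ x, χ.mulX x * conv lnAbs.deriv χ x =
      (∫ x, χ x * conv lnAbs.deriv χ.mulX x) + (∫ x, χ x) ^ 2 := by
    rw [sq, ← integral_mul_const, ← integral_add (χ.integrable_mul_conv _ _)
      (χ.integrable.mul_const _)]
    congr 1 with x
    rw [Test.mulX_apply]
    linear_combination χ x * mul_conv_lnAbs_deriv χ x
  rw [integral_mul_conv_lnAbs_deriv_antisymm χ] at hcomm
  linear_combination hcomm / 2

end Logarithm

section CrossTerms

/-- The representative of `X₋⁻² · H - Ln x₊ · D'` built from the test function `d` in place of the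
mollifier, with `X₋⁻²` expanded as in `conv_negPowMinus_one`. -/
noncomputable def crossMinus (d : Test) (t : ℝ) : ℂ :=
  (-conv lnMinus d.deriv.deriv t + d.deriv t) * conv heaviside d t - conv lnPlus d t * d.deriv t

/-- The representative of `X₊⁻² · Ȟ + Ln x₋ · D'` built from the test function `d` in place of the
mollifier, with `X₊⁻²` expanded as in `conv_negPowPlus_one`. -/
noncomputable def crossPlus (d : Test) (t : ℝ) : ℂ :=
  (-conv lnPlus d.deriv.deriv t - d.deriv t) * conv heavisideRef d t + conv lnMinus d t * d.deriv t

/-- A compactly supported function whose derivative is `crossMinus d + d² - d · (pv(1/x) * d)`.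
Integrating that identity, and `x` times it, gives the first two moments of `crossMinus d`. -/
noncomputable def crossPrimitive (d : Test) (t : ℝ) : ℂ :=
  (-conv lnMinus d.deriv t + d t) * conv heaviside d t - conv lnPlus d t * d t

lemma conv_negPowMinus_one (χ : Test) (x : ℝ) :
    conv (negPowMinus 1) χ x = -conv lnMinus χ.deriv.deriv x + χ.deriv x := by
  change (-1 / (Nat.factorial 1 : ℂ)) * conv lnMinus.deriv.deriv χ x +
    (kappa 1 / (Nat.factorial 1 : ℂ)) * conv delta.deriv χ x = _
  simp [kappa, conv_deriv, conv_delta]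

lemma conv_negPowPlus_one (χ : Test) (x : ℝ) :
    conv (negPowPlus 1) χ x = -conv lnPlus χ.deriv.deriv x - χ.deriv x := by
  change ((-1) ^ 1 / (Nat.factorial 1 : ℂ)) * conv lnPlus.deriv.deriv χ x +
    ((-1) ^ 1 * kappa 1 / (Nat.factorial 1 : ℂ)) * conv delta.deriv χ x = _
  simp [kappa, conv_deriv, conv_delta, sub_eq_add_neg]

lemma crossMinus_dilate (d : Test) {σ : ℝ} (hσ : 0 < σ) (t : ℝ) :
    crossMinus (dilate σ d) (σ * t) = ((σ : ℂ)⁻¹) ^ 2 * crossMinus d t := by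
  have hderiv : ((σ⁻¹ : ℂ) • dilate σ d.deriv) (σ * t) = (σ⁻¹ : ℂ) * ((σ⁻¹ : ℂ) * d.deriv t) := by
    change (σ⁻¹ : ℂ) * dilate σ d.deriv (σ * t) = _
    rw [dilate_apply, inv_mul_cancel_left₀ hσ.ne']
  simp only [crossMinus, Test.deriv_dilate, Test.deriv_smul, conv_smul, hderiv,
    conv_lnMinus_dilate _ hσ, conv_lnPlus_dilate _ hσ, conv_heaviside_dilate _ hσ,
    conv_heavisideRef_deriv]
  ring

lemma crossPlus_eq_crossMinus_reflect (d : Test) (t : ℝ) :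
    crossPlus d t = crossMinus (reflect d 0) (-t) := by
  have hPlus (χ : Test) : conv lnPlus χ t = conv lnMinus (reflect χ 0) (-t) := by
    rw [lnPlus, lnPlusFun_eq_comp_neg, lnMinus, conv_ofFun_comp_neg locallyIntegrable_lnMinusFun]
  have hMinus (χ : Test) : conv lnMinus χ t = conv lnPlus (reflect χ 0) (-t) := by
    rw [lnMinus, lnMinusFun_eq_comp_neg, lnPlus, conv_ofFun_comp_neg locallyIntegrable_lnPlusFun]
  have hRef (χ : Test) : conv heavisideRef χ t = conv heaviside (reflect χ 0) (-t) := by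
    rw [heavisideRef, heavisideRefFun_eq_comp_neg, heaviside,
      conv_ofFun_comp_neg locallyIntegrable_heavisideFun]
  have hderiv : (reflect d 0).deriv (-t) = -d.deriv t := by
    rw [Test.deriv_reflect]
    change -d.deriv (0 - -t) = _
    rw [zero_sub, neg_neg]
  have hderiv₂ : (reflect d 0).deriv.deriv = reflect d.deriv.deriv 0 := by
    rw [Test.deriv_reflect, Test.deriv_neg, Test.deriv_reflect, neg_neg]
  rw [crossPlus, crossMinus, hPlus, hMinus, hRef, hderiv, hderiv₂]
  ring

lemma reflect_zero_dilate (σ : ℝ) (d : Test) :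
    reflect (dilate σ d) 0 = dilate σ (reflect d 0) := by
  ext x
  simp only [reflect_apply, dilate_apply, zero_sub, mul_neg]

lemma crossPlus_dilate (d : Test) {σ : ℝ} (hσ : 0 < σ) (t : ℝ) :
    crossPlus (dilate σ d) (σ * t) = ((σ : ℂ)⁻¹) ^ 2 * crossPlus d t := by
  rw [crossPlus_eq_crossMinus_reflect, crossPlus_eq_crossMinus_reflect, reflect_zero_dilate,
    ← mul_neg, crossMinus_dilate _ hσ]

lemma continuous_crossMinus (d : Test) : Continuous (crossMinus d) :=
  (((continuous_conv _ _).neg.add d.deriv.continuous).mul (continuous_conv _ _)).sub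
    ((continuous_conv _ _).mul d.deriv.continuous)

lemma continuous_crossPrimitive (d : Test) : Continuous (crossPrimitive d) :=
  (((continuous_conv _ _).neg.add d.continuous).mul (continuous_conv _ _)).sub
    ((continuous_conv _ _).mul d.continuous)

lemma support_conv_lnMinus_mul_conv_heaviside {χ ψ : Test} {l : ℝ}
    (hχ : ∀ x, χ x ≠ 0 → |x| ≤ l) (hψ : ∀ x, ψ x ≠ 0 → |x| ≤ l) (x : ℝ)
    (hx : conv lnMinus χ x * conv heaviside ψ x ≠ 0) : |x| ≤ l := by
  refine abs_le.2 ⟨?_, ?_⟩ <;> by_contra! h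
  · exact right_ne_zero_of_mul hx (conv_heaviside_eq_zero hψ h)
  · exact left_ne_zero_of_mul hx (conv_lnMinus_eq_zero hχ h)

lemma support_crossMinus {d : Test} {l : ℝ} (hl : ∀ x, d x ≠ 0 → |x| ≤ l) (x : ℝ)
    (hx : crossMinus d x ≠ 0) : |x| ≤ l := by
  have hl' := d.support_deriv hl
  contrapose! hx
  have hd' : d.deriv x = 0 := not_not.1 (mt (hl' x) hx.not_ge)
  have hprod : conv lnMinus d.deriv.deriv x * conv heaviside d x = 0 := not_not.1
    (mt (support_conv_lnMinus_mul_conv_heaviside (d.deriv.support_deriv hl') hl x) hx.not_ge)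
  rw [crossMinus, hd']
  linear_combination -hprod

lemma support_crossPrimitive {d : Test} {l : ℝ} (hl : ∀ x, d x ≠ 0 → |x| ≤ l) (x : ℝ)
    (hx : crossPrimitive d x ≠ 0) : |x| ≤ l := by
  contrapose! hx
  have hd : d x = 0 := not_not.1 (mt (hl x) hx.not_ge)
  have hprod : conv lnMinus d.deriv x * conv heaviside d x = 0 := not_not.1
    (mt (support_conv_lnMinus_mul_conv_heaviside (d.support_deriv hl) hl x) hx.not_ge)
  rw [crossPrimitive, hd]
  linear_combination -hprod

lemma integrable_conv_lnMinus_mul_conv_heaviside (χ ψ : Test) :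
    Integrable fun x => conv lnMinus χ x * conv heaviside ψ x := by
  obtain ⟨l, hl⟩ := χ.exists_support
  obtain ⟨m, hm⟩ := ψ.exists_support
  exact integrable_of_support ((continuous_conv _ _).mul (continuous_conv _ _))
    (support_conv_lnMinus_mul_conv_heaviside (l := max l m)
      (fun x hx => (hl x hx).trans (le_max_left l m))
      fun x hx => (hm x hx).trans (le_max_right l m))

lemma integrable_crossMinus (d : Test) : Integrable (crossMinus d) := by
  obtain ⟨l, hl⟩ := d.exists_support
  exact integrable_of_support (continuous_crossMinus d) (support_crossMinus hl)

lemma integrable_mul_crossMinus (d : Test) : Integrable fun x : ℝ => (x : ℂ) * crossMinus d x := by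
  obtain ⟨l, hl⟩ := d.exists_support
  exact integrable_of_support (Complex.continuous_ofReal.mul (continuous_crossMinus d))
    fun x hx => support_crossMinus hl x (right_ne_zero_of_mul hx)

lemma integrable_crossPrimitive (d : Test) : Integrable (crossPrimitive d) := by
  obtain ⟨l, hl⟩ := d.exists_support
  exact integrable_of_support (continuous_crossPrimitive d) (support_crossPrimitive hl)

lemma integrable_mul_crossPrimitive (d : Test) :
    Integrable fun x : ℝ => (x : ℂ) * crossPrimitive d x := by
  obtain ⟨l, hl⟩ := d.exists_support
  exact integrable_of_support (Complex.continuous_ofReal.mul (continuous_crossPrimitive d))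
    fun x hx => support_crossPrimitive hl x (right_ne_zero_of_mul hx)

lemma crossPrimitive_hasDerivAt (d : Test) (x : ℝ) :
    HasDerivAt (crossPrimitive d)
      (crossMinus d x + d x ^ 2 - d x * conv lnAbs.deriv d x) x := by
  have h := (((conv_hasDerivAt lnMinus d.deriv x).neg.add (d.hasDerivAt x)).mul
    (conv_heaviside_hasDerivAt d x)).sub ((conv_hasDerivAt lnPlus d x).mul (d.hasDerivAt x))
  refine h.congr_deriv ?_
  simp only [conv_deriv, ← conv_lnMinus_add_conv_lnPlus, crossMinus, Pi.add_apply, Pi.neg_apply]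
  ring

lemma integral_conv_lnMinus_deriv_mul_conv_heaviside (χ ψ : Test) :
    ∫ x, conv lnMinus χ.deriv x * conv heaviside ψ x = -∫ x, ψ x * conv lnMinus χ x := by
  have hparts := integral_mul_deriv_eq_deriv_mul_of_integrable
    (fun x _ => conv_hasDerivAt lnMinus χ x) (fun x _ => conv_heaviside_hasDerivAt ψ x)
    ((ψ.integrable_mul_conv lnMinus χ).congr (.of_forall fun x => mul_comm _ _))
    (integrable_conv_lnMinus_mul_conv_heaviside χ.deriv ψ)
    (integrable_conv_lnMinus_mul_conv_heaviside χ ψ)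
  simp only [mul_comm (ψ _), hparts, neg_neg]

lemma integral_crossPrimitive (d : Test) : ∫ x, crossPrimitive d x = (∫ x, d x) ^ 2 / 2 := by
  have hLH := integrable_conv_lnMinus_mul_conv_heaviside d.deriv d
  have hH := d.integrable_mul_conv heaviside d
  have hL := d.integrable_mul_conv lnPlus d
  have hexpand : ∀ x, crossPrimitive d x = d x * conv heaviside d x -
      conv lnMinus d.deriv x * conv heaviside d x - d x * conv lnPlus d x := fun x => by
    rw [crossPrimitive]
    ring
  simp only [hexpand]
  rw [integral_sub (hH.sub' hLH) hL, integral_sub hH hLH, integral_mul_conv_heaviside,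
    integral_conv_lnMinus_deriv_mul_conv_heaviside, integral_mul_conv_lnPlus]
  ring

lemma integral_crossMinus (d : Test) : ∫ x, crossMinus d x = -∫ x, d x ^ 2 := by
  have hC := integrable_crossMinus d
  have hd := d.integrable_sq
  have hpv := d.integrable_mul_conv lnAbs.deriv d
  have h := integral_eq_zero_of_hasDerivAt_of_integrable (crossPrimitive_hasDerivAt d)
    ((hC.fun_add hd).sub hpv) (integrable_crossPrimitive d)
  rw [integral_sub (hC.fun_add hd) hpv, integral_add hC hd, integral_mul_conv_lnAbs_deriv_self] at h
  linear_combination h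

lemma integral_mul_crossMinus (d : Test) :
    ∫ x : ℝ, (x : ℂ) * crossMinus d x = -∫ x : ℝ, (x : ℂ) * d x ^ 2 := by
  have hC := integrable_mul_crossMinus d
  have hd : Integrable fun x : ℝ => (x : ℂ) * d x ^ 2 := by
    simpa only [Test.mulX_apply, mul_assoc, ← sq] using
      d.mulX.integrable_mul d.continuous.locallyIntegrable
  have hpv := d.mulX.integrable_mul_conv lnAbs.deriv d
  have hexpand : ∀ x : ℝ, (x : ℂ) * (crossMinus d x + d x ^ 2 - d x * conv lnAbs.deriv d x) =
      x * crossMinus d x + x * d x ^ 2 - d.mulX x * conv lnAbs.deriv d x := fun x => by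
    rw [Test.mulX_apply]
    ring
  have hparts := integral_mul_deriv_eq_deriv_mul_of_integrable
    (fun x _ => (Complex.ofRealCLM.hasDerivAt (x := x)))
    (fun x _ => crossPrimitive_hasDerivAt d x)
    (((hC.fun_add hd).sub hpv).congr (.of_forall fun x => (hexpand x).symm))
    ((integrable_crossPrimitive d).congr (.of_forall fun x => (one_mul _).symm))
    (integrable_mul_crossPrimitive d)
  simp only [Complex.ofRealCLM_apply, Complex.ofReal_one, one_mul, hexpand] at hparts
  rw [integral_sub (hC.fun_add hd) hpv, integral_add hC hd, integral_crossPrimitive,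
    integral_mulX_mul_conv_lnAbs_deriv_self] at hparts
  linear_combination hparts

lemma exists_bound_crossMinus {ι : Type*} {F : Filter ι} {d : ι → Test} {l : ℝ}
    (hl : ∀ᶠ i in F, ∀ x, d i x ≠ 0 → |x| ≤ l)
    (hB : ∀ k : ℕ, ∃ C : ℝ, ∀ᶠ i in F, ∀ x, ‖iteratedDeriv k (d i) x‖ ≤ C) :
    ∃ C : ℝ, ∀ᶠ i in F, ∀ x, ‖crossMinus (d i) x‖ ≤ C := by
  obtain ⟨C₁, h₁⟩ := exists_bound_conv lnMinus hl hB 2 l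
  obtain ⟨C₂, h₂⟩ := hB 1
  obtain ⟨C₃, h₃⟩ := exists_bound_conv heaviside hl hB 0 l
  obtain ⟨C₄, h₄⟩ := exists_bound_conv lnPlus hl hB 0 l
  refine ⟨|(C₁ + C₂) * C₃ + C₄ * C₂|, ?_⟩
  filter_upwards [hl, h₁, h₂, h₃, h₄] with i hsupp h₁ h₂ h₃ h₄ x
  by_cases hx : |x| ≤ l
  · have hd' : ‖(d i).deriv x‖ ≤ C₂ := by simpa only [Test.coe_deriv, iteratedDeriv_one] using h₂ x
    refine le_trans ?_ (le_abs_self _)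
    exact norm_sub_le_of_le (norm_mul_le_of_le
      (norm_add_le_of_le ((norm_neg _).trans_le (h₁ x hx)) hd') (h₃ x hx))
      (norm_mul_le_of_le (h₄ x hx) hd')
  · rw [not_not.1 (mt (support_crossMinus hsupp x) hx), norm_zero]
    exact abs_nonneg _

end CrossTerms

section Concentration

lemma norm_integral_mul_comp_mul_sub_le {f : ℝ → ℂ} {l M B σ : ℝ} (hσ : 0 ≤ σ) (hl0 : 0 ≤ l)
    (hf : Continuous f) (hl : ∀ x, f x ≠ 0 → |x| ≤ l) (hM : ∀ x, ‖f x‖ ≤ M)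
    (hmoment : ∫ x : ℝ, (x : ℂ) * f x = 0) (ψ : Test) (hB : ∀ x, ‖iteratedDeriv 2 ψ x‖ ≤ B) :
    ‖(∫ x, f x * ψ (σ * x)) - (∫ x, f x) * ψ 0‖ ≤ M * (B * (σ * l) ^ 2) * (2 * l) := by
  have hint := (integrable_of_support hf hl).mul_const (ψ 0)
  have hint₁ : Integrable fun x : ℝ => (x : ℂ) * f x * (σ * ψ.deriv 0) :=
    (integrable_of_support (Complex.continuous_ofReal.mul hf)
      fun x hx => hl x (right_ne_zero_of_mul hx)).mul_const _
  have hintψ : Integrable fun x : ℝ => f x * ψ (σ * x) :=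
    integrable_of_support (hf.mul (ψ.continuous.comp (continuous_const.mul continuous_id)))
      fun x hx => hl x (left_ne_zero_of_mul hx)
  have hremainder : (∫ x, f x * ψ (σ * x)) - (∫ x, f x) * ψ 0 =
      ∫ x : ℝ, f x * (ψ (σ * x) - ψ 0 - (σ * x : ℝ) * ψ.deriv 0) := by
    have hexpand : ∀ x : ℝ, f x * (ψ (σ * x) - ψ 0 - (σ * x : ℝ) * ψ.deriv 0) =
        f x * ψ (σ * x) - f x * ψ 0 - x * f x * (σ * ψ.deriv 0) := fun x => by
      push_cast
      ring
    simp_rw [hexpand]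
    rw [integral_sub (hintψ.sub' hint) hint₁, integral_sub hintψ hint, integral_mul_const,
      integral_mul_const, hmoment, zero_mul, sub_zero]
  rw [hremainder]
  refine norm_integral_mul_le hl0 hl hM fun x hx => ?_
  have htaylor := taylor_bound ψ 0 hB 0 (σ * x)
  simp only [iteratedDeriv_zero, zero_add, iteratedDeriv_one, ← Test.coe_deriv] at htaylor
  refine htaylor.trans (mul_le_mul_of_nonneg_left ?_ ((norm_nonneg _).trans (hB 0)))
  rw [← sq_abs (σ * x), abs_mul, abs_of_nonneg hσ]
  gcongr

/-- A family `f σ` for which the rescaled functions `σ⁻² f σ (x / σ)` tend to `c δ` as `σ → 0₊`.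
The scaling is one power of `σ` stronger than the usual one, so the integral of `f σ` is to be
`c σ`, and the first moment, which would contribute to order `1`, has to vanish. -/
structure IsDeltaFamily (c : ℂ) (f : ℝ → ℝ → ℂ) : Prop where
  continuous : ∀ᶠ σ in 𝓝[>] (0 : ℝ), Continuous (f σ)
  support_bounded : ∃ l : ℝ, ∀ᶠ σ in 𝓝[>] (0 : ℝ), ∀ x, f σ x ≠ 0 → |x| ≤ l
  bounded : ∃ M : ℝ, ∀ᶠ σ in 𝓝[>] (0 : ℝ), ∀ x, ‖f σ x‖ ≤ M
  integral_eq : ∀ᶠ σ : ℝ in 𝓝[>] 0, ∫ x, f σ x = c * σ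
  integral_mul_eq_zero : ∀ᶠ σ in 𝓝[>] (0 : ℝ), ∫ x : ℝ, (x : ℂ) * f σ x = 0

namespace IsDeltaFamily

variable {c : ℂ} {f : ℝ → ℝ → ℂ}

lemma comp_neg (h : IsDeltaFamily c f) : IsDeltaFamily c fun σ x => f σ (-x) where
  continuous := h.continuous.mono fun _ hf => hf.comp continuous_neg
  support_bounded := by
    obtain ⟨l, hl⟩ := h.support_bounded
    exact ⟨l, hl.mono fun σ hf x hx => abs_neg x ▸ hf (-x) hx⟩
  bounded := by
    obtain ⟨M, hM⟩ := h.bounded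
    exact ⟨M, hM.mono fun σ hf x => hf (-x)⟩
  integral_eq := h.integral_eq.mono fun σ hf => (integral_neg_eq_self (f σ) volume).trans hf
  integral_mul_eq_zero := h.integral_mul_eq_zero.mono fun σ hf => by
    rw [← integral_neg_eq_self] at hf
    simpa only [Complex.ofReal_neg, neg_mul, integral_neg, neg_eq_zero] using hf

lemma tendsto (h : IsDeltaFamily c f) (ψ : Test) :
    Tendsto (fun σ : ℝ => (σ⁻¹ : ℂ) * ∫ x, f σ x * ψ (σ * x)) (𝓝[>] 0) (𝓝 (c * ψ 0)) := by
  obtain ⟨l, hl⟩ := h.support_bounded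
  obtain ⟨M, hM⟩ := h.bounded
  obtain ⟨B, -, hB⟩ := ψ.exists_bound 2
  have hlim : Tendsto (fun σ : ℝ => M * (B * |l| ^ 2) * (2 * |l|) * σ) (𝓝[>] 0) (𝓝 0) := by
    have h₀ := (tendsto_id (α := ℝ) (x := 𝓝 0)).const_mul (M * (B * |l| ^ 2) * (2 * |l|))
    rw [mul_zero] at h₀
    exact h₀.mono_left nhdsWithin_le_nhds
  rw [tendsto_iff_norm_sub_tendsto_zero]
  refine squeeze_zero' (.of_forall fun _ => norm_nonneg _) ?_ hlim
  filter_upwards [h.continuous, hl, hM, h.integral_eq, h.integral_mul_eq_zero,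
    self_mem_nhdsWithin] with σ hf hl hM h₀ h₁ (hσ : 0 < σ)
  have hσ' : (σ : ℂ) ≠ 0 := by exact_mod_cast hσ.ne'
  have hbound := norm_integral_mul_comp_mul_sub_le hσ.le (abs_nonneg l) hf
    (fun x hx => (hl x hx).trans (le_abs_self l)) hM h₁ ψ hB
  have hfactor : (σ⁻¹ : ℂ) * (∫ x, f σ x * ψ (σ * x)) - c * ψ 0 =
      (σ⁻¹ : ℂ) * ((∫ x, f σ x * ψ (σ * x)) - (∫ x, f σ x) * ψ 0) := by
    rw [h₀]
    field_simp
  rw [hfactor, norm_mul, norm_inv, Complex.norm_real, Real.norm_eq_abs, abs_of_pos hσ]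
  calc _ ≤ σ⁻¹ * (M * (B * (σ * |l|) ^ 2) * (2 * |l|)) := by gcongr
    _ = M * (B * |l| ^ 2) * (2 * |l|) * σ := by field_simp

end IsDeltaFamily

lemma neg_one_smul_delta : (-1 : ℂ) • delta = -delta :=
  ContinuousLinearMap.ext fun ψ => neg_one_mul (ψ 0)

lemma tendsto_size_scale (φ : A 0) :
    Tendsto (fun ε : ℝ => size (scale ε φ)) (𝓝[>] 0) (𝓝[>] 0) := by
  refine tendsto_nhdsWithin_iff.2 ⟨?_, .of_forall fun ε => size_pos _⟩
  have h := (tendsto_id (α := ℝ) (x := 𝓝 0)).mul_const (size φ)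
  rw [zero_mul] at h
  refine (h.mono_left nhdsWithin_le_nhds).congr' ?_
  filter_upwards [self_mem_nhdsWithin] with ε hε using (size_scale hε φ).symm

lemma IsDeltaFamily.assoc {c : ℂ} {f : ℝ → ℝ → ℂ} (h : IsDeltaFamily c f) {X : Moderate}
    (hX : ∀ (φ : A 0) (t : ℝ), X.1 φ (size φ * t) = ((size φ : ℂ)⁻¹) ^ 2 * f (size φ) t) :
    Assoc (Ideal.Quotient.mk Null X) (c • delta) := by
  refine ⟨X.1, X.2, rfl, fun ψ => ⟨0, fun φ _ => ?_⟩⟩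
  refine ((h.tendsto ψ).comp (tendsto_size_scale φ)).congr fun ε => ?_
  have hσ := size_pos (scale ε φ)
  have hσ' : ((size (scale ε φ) : ℂ))⁻¹ ≠ 0 := inv_ne_zero (by exact_mod_cast hσ.ne')
  have hsubst := Measure.integral_comp_mul_left (fun x => X.1 (scale ε φ) x * ψ x)
    (size (scale ε φ))
  simp only [hX, mul_assoc, integral_const_mul] at hsubst
  rw [abs_of_pos (inv_pos.2 hσ), Complex.real_smul, Complex.ofReal_inv, sq, mul_assoc] at hsubst
  exact mul_left_cancel₀ hσ' hsubst

lemma IsDeltaFamily.crossMinus {c : ℂ} {d : ℝ → Test} (h : IsDeltaFamily c fun σ x => d σ x ^ 2)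
    (hB : ∀ k : ℕ, ∃ C : ℝ, ∀ᶠ σ in 𝓝[>] (0 : ℝ), ∀ x, ‖iteratedDeriv k (d σ) x‖ ≤ C) :
    IsDeltaFamily (-c) fun σ => crossMinus (d σ) := by
  obtain ⟨l, hl⟩ := h.support_bounded
  replace hl : ∀ᶠ σ in 𝓝[>] (0 : ℝ), ∀ x, d σ x ≠ 0 → |x| ≤ l :=
    hl.mono fun σ hd x hx => hd x (pow_ne_zero 2 hx)
  exact
    { continuous := .of_forall fun σ => continuous_crossMinus (d σ)
      support_bounded := ⟨l, hl.mono fun σ => support_crossMinus⟩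
      bounded := exists_bound_crossMinus hl hB
      integral_eq := h.integral_eq.mono fun σ hd => by rw [integral_crossMinus, hd, neg_mul]
      integral_mul_eq_zero := h.integral_mul_eq_zero.mono fun σ hd => by
        rw [integral_mul_crossMinus, hd, neg_zero] }

end Concentration

namespace DeltaModel

variable (D : DeltaModel)

/-- The representative `D.rep u` of the model of `u`, as an element of the algebra `Moderate`, in
which products of models are computed. -/
noncomputable def moderateRep (u : Distr) : Moderate := ⟨D.rep u, D.isModerate_rep u⟩

lemma rep_delta_mul (φ : A 0) (t : ℝ) :
    D.rep delta φ (size φ * t) = (size φ : ℂ)⁻¹ * D.profile (size φ) t := by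
  rw [rep, net, conv_delta, dilate_apply, inv_mul_cancel_left₀ (size_pos φ).ne']

lemma exists_bound_profile : ∃ C : ℝ, ∀ᶠ s in 𝓝[>] (0 : ℝ), ∀ x, ‖D.profile s x‖ ≤ C := by
  simpa only [iteratedDeriv_zero] using D.deriv_bounded 0

lemma integral_profile_sq {s : ℝ} (hs : 0 < s) : ∫ x, D.profile s x ^ 2 = s := by
  have hs' : (s : ℂ) ≠ 0 := by exact_mod_cast hs.ne'
  have h := D.integral_sq s hs
  field_simp at h
  exact h

lemma reflect_profile {s : ℝ} (hs : 0 < s) : reflect (D.profile s) 0 = D.profile s := by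
  ext x
  rw [reflect_apply, zero_sub, D.even s hs]

lemma isDeltaFamily_profile : IsDeltaFamily 1 fun σ x => σ * D.profile σ x where
  continuous := .of_forall fun σ => continuous_const.mul (D.profile σ).continuous
  support_bounded := by
    obtain ⟨l, hl⟩ := D.support_bounded
    exact ⟨l, hl.mono fun σ h x hx => h x (right_ne_zero_of_mul hx)⟩
  bounded := by
    obtain ⟨C, hC⟩ := D.exists_bound_profile
    refine ⟨C, ?_⟩
    filter_upwards [hC, eventually_small] with σ hC ⟨hσ₀, hσ₁⟩ x
    rw [norm_mul, Complex.norm_real, Real.norm_eq_abs, abs_of_pos hσ₀]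
    exact (mul_le_of_le_one_left (norm_nonneg _) hσ₁.le).trans (hC x)
  integral_eq := by
    filter_upwards [self_mem_nhdsWithin] with σ hσ
    rw [integral_const_mul, D.integral_eq σ hσ, mul_comm]
  integral_mul_eq_zero := by
    filter_upwards [self_mem_nhdsWithin] with σ hσ
    refine integral_eq_zero_of_odd fun x => ?_
    rw [D.even σ hσ, Complex.ofReal_neg, neg_mul]

lemma isDeltaFamily_profile_sq : IsDeltaFamily 1 fun σ x => D.profile σ x ^ 2 where
  continuous := .of_forall fun σ => (D.profile σ).continuous.pow 2
  support_bounded := by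
    obtain ⟨l, hl⟩ := D.support_bounded
    exact ⟨l, hl.mono fun σ h x hx => h x (ne_zero_pow two_ne_zero hx)⟩
  bounded := by
    obtain ⟨C, hC⟩ := D.exists_bound_profile
    refine ⟨C ^ 2, hC.mono fun σ h x => ?_⟩
    rw [norm_pow]
    gcongr
    exact h x
  integral_eq := by
    filter_upwards [self_mem_nhdsWithin] with σ hσ
    rw [D.integral_profile_sq hσ, one_mul]
  integral_mul_eq_zero := by
    filter_upwards [self_mem_nhdsWithin] with σ hσ
    refine integral_eq_zero_of_odd fun x => ?_
    rw [D.even σ hσ, Complex.ofReal_neg, neg_mul]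

lemma assoc_delta : Assoc (D.model delta) delta := by
  have h := D.isDeltaFamily_profile.assoc (X := D.moderateRep delta) fun φ t => by
    have hσ : (size φ : ℂ) ≠ 0 := by exact_mod_cast (size_pos φ).ne'
    change D.rep delta φ (size φ * t) = _
    rw [rep_delta_mul]
    field_simp
  rwa [one_smul] at h

lemma assoc_delta_sq : Assoc (D.model delta ^ 2) delta := by
  have h := D.isDeltaFamily_profile_sq.assoc (X := D.moderateRep delta ^ 2) fun φ t => by
    change D.rep delta φ (size φ * t) ^ 2 = _
    rw [rep_delta_mul, mul_pow]
  rwa [one_smul, map_pow] at h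

lemma assoc_crossMinus :
    Assoc (D.model (negPowMinus 1) * D.model heaviside - D.model lnPlus * D.model delta.deriv)
      (-delta) := by
  have h := (D.isDeltaFamily_profile_sq.crossMinus D.deriv_bounded).assoc
    (X := D.moderateRep (negPowMinus 1) * D.moderateRep heaviside -
      D.moderateRep lnPlus * D.moderateRep delta.deriv) fun φ t => by
    rw [← crossMinus_dilate _ (size_pos φ)]
    change D.rep _ φ _ * D.rep _ φ _ - D.rep _ φ _ * D.rep _ φ _ = _
    simp only [rep, net, conv_negPowMinus_one, conv_deriv, conv_delta, crossMinus]
  rwa [neg_one_smul_delta, RingHom.map_sub, RingHom.map_mul, RingHom.map_mul] at h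

lemma assoc_crossPlus :
    Assoc (D.model (negPowPlus 1) * D.model heavisideRef + D.model lnMinus * D.model delta.deriv)
      (-delta) := by
  have h := (D.isDeltaFamily_profile_sq.crossMinus D.deriv_bounded).comp_neg.assoc
    (X := D.moderateRep (negPowPlus 1) * D.moderateRep heavisideRef +
      D.moderateRep lnMinus * D.moderateRep delta.deriv) fun φ t => by
    have hreflect : crossMinus (D.profile (size φ)) (-t) = crossPlus (D.profile (size φ)) t := by
      rw [crossPlus_eq_crossMinus_reflect, D.reflect_profile (size_pos φ)]
    rw [hreflect, ← crossPlus_dilate _ (size_pos φ)]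
    change D.rep _ φ _ * D.rep _ φ _ + D.rep _ φ _ * D.rep _ φ _ = _
    simp only [rep, net, conv_negPowPlus_one, conv_deriv, conv_delta, crossPlus]
  rwa [neg_one_smul_delta, RingHom.map_add, RingHom.map_mul, RingHom.map_mul] at h

end DeltaModel

end Colombeau

theorem theorem1 (D : Colombeau.DeltaModel) :
    -- `D ≈ δ` and `D² ≈ δ`
    Colombeau.Assoc (D.model Colombeau.delta) Colombeau.delta ∧
    Colombeau.Assoc (D.model Colombeau.delta ^ 2) Colombeau.delta ∧
    -- `X₋⁻² · H - Ln x₊ · D' ≈ -δ`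
    Colombeau.Assoc
      (D.model (Colombeau.negPowMinus 1) * D.model Colombeau.heaviside
        - D.model Colombeau.lnPlus * D.model Colombeau.delta.deriv)
      (-Colombeau.delta) ∧
    -- `X₊⁻² · Ȟ + Ln x₋ · D' ≈ -δ`
    Colombeau.Assoc
      (D.model (Colombeau.negPowPlus 1) * D.model Colombeau.heavisideRef
        + D.model Colombeau.lnMinus * D.model Colombeau.delta.deriv)
      (-Colombeau.delta) :=
  ⟨D.assoc_delta, D.assoc_delta_sq, D.assoc_crossMinus, D.assoc_crossPlus⟩
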